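/- For a finite group $G$, let $\Gamma(G)$ be the graph whose vertices are the subgroups of $G$, two distinct subgroups $H_1,H_2$ being adjacent if and only if one of them, say $H_1$, is properly contained in the other and there is no subgroup $K$ with $H_1<K<H_2$. For a finite graph $\Gamma$, let $\gamma(\Gamma)$ denote its genus, that is, the minimum $g\ge 0$ such that $\Gamma$ embeds into the closed connected orientable surface $S_g$ of genus $g$, where "$\Gamma$ embeds into $S_g$" means that $S_g$ has a finite cell decomposition whose $1$-skeleton contains $\Gamma$ as a subgraph. Then for every prime $p$, $$\gamma\bigl(\Gamma(\mathbb{Z}_{p^2}\times\mathbb{Z}_{p^2})\bigr)=\left\lceil \frac{p-1}{4}\right\rceil ,$$ where $\mathbb{Z}_{n}$ denotes the cyclic group of order $n$. -/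

import Mathlib

/-- The number of orbits (cycles, fixed points included) of a permutation. -/
noncomputable def numOrbits {D : Type*} (π : Equiv.Perm D) : ℕ :=
  Nat.card (Quotient (Equiv.Perm.SameCycle.setoid π))

/-- A closed connected oriented surface with a finite cell decomposition having at least one edge,
given as a combinatorial map. A dart is an edge together with a direction; `rev` reverses the
direction, and `rot` sends a dart to the next dart, in the positive sense of the orientation,
leaving the same vertex. Hence the vertices are the orbits of `rot`, the edges are the orbits of
`rev`, and the faces (open discs, one for each closed boundary walk) are the orbits of
`d ↦ rot (rev d)`. Loops and multiple edges are allowed. -/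
structure CellSurface where
  Dart : Type
  finite_dart : Finite Dart
  nonempty_dart : Nonempty Dart
  rot : Equiv.Perm Dart
  rev : Equiv.Perm Dart
  rev_rev : ∀ d, rev (rev d) = d
  rev_ne : ∀ d, rev d ≠ d
  /-- The surface is connected. -/
  connected : ∀ d e : Dart, ∃ π ∈ Subgroup.closure {rot, rev}, π d = e

namespace CellSurface

/-- The vertices of the cell decomposition. -/
def Vertex (S : CellSurface) : Type :=
  Quotient (Equiv.Perm.SameCycle.setoid S.rot)

/-- The initial vertex of a dart. -/
def origin (S : CellSurface) (d : S.Dart) : S.Vertex :=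
  Quotient.mk (Equiv.Perm.SameCycle.setoid S.rot) d

/-- The Euler characteristic: vertices minus edges plus faces. -/
noncomputable def eulerChar (S : CellSurface) : ℤ :=
  (numOrbits S.rot : ℤ) - (numOrbits S.rev : ℤ) + (numOrbits (S.rot * S.rev) : ℤ)

/-- The surface is the closed connected orientable surface of genus `g`. -/
def HasGenus (S : CellSurface) (g : ℕ) : Prop :=
  S.eulerChar = 2 - 2 * (g : ℤ)

end CellSurface

/-- The graph `Γ` embeds into the closed connected orientable surface of genus `g`: the surface has
a cell decomposition whose 1-skeleton contains `Γ` as a subgraph. Distinct vertices go to distinct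
vertices, and then distinct edges of the simple graph `Γ` automatically go to distinct edges. The
1-skeleton may contain further vertices and edges, so the regions into which `Γ` itself divides the
surface need not be discs, and `Γ` need not be connected. -/
def SimpleGraph.EmbedsInGenus {V : Type*} (Γ : SimpleGraph V) (g : ℕ) : Prop :=
  ∃ S : CellSurface, S.HasGenus g ∧
    ∃ f : V → S.Vertex, Function.Injective f ∧
      ∀ u v : V, Γ.Adj u v → ∃ d : S.Dart, S.origin d = f u ∧ S.origin (S.rev d) = f v

/-- The genus of a graph: the minimum `g` such that the graph embeds into the orientable surface
of genus `g` (and `⊤` if there is no such `g`). -/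
noncomputable def SimpleGraph.genus {V : Type*} (Γ : SimpleGraph V) : ℕ∞ :=
  ⨅ (g : ℕ) (_ : Γ.EmbedsInGenus g), (g : ℕ∞)

/-- The subgroup lattice graph of an additive group: the vertices are the subgroups, and two of
them are adjacent when one is strictly contained in the other with no subgroup strictly between. -/
def subgroupLatticeGraph (G : Type*) [AddGroup G] : SimpleGraph (AddSubgroup G) :=
  SimpleGraph.hasse (AddSubgroup G)

/-! Write T for the subgroup of elements killed by p; here T = pG. A subgroup H neither inside nor
above T satisfies pH = H ∩ T, a subgroup of order p. So the graph has three hubs 0, T, G and, for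
each of the p + 1 subgroups A of order p, a bundle: A is joined to 0 and T, its preimage p⁻¹A to T
and G, and the middle subgroups H of order p² with pH = H ∩ T = A are joined to A and p⁻¹A
(`exists_hasKind`, `link_of_covBy`).

Lower bound. One middle subgroup for each A yields a subdivided K_{3,n}, n = p + 1, with the hubs on
one side and the atoms on the other. Linear algebra over ℚ on an arbitrary cell decomposition gives
cycle rank + 1 ≤ regions + 2g, without requiring regions to be discs
(`CellSurface.finrank_cyclesOn_add_one_le`). If there are at least two regions, each boundary is a
nonzero cycle, hence uses at least four of the 3n subdivided edges, and each edge borders at most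
two regions, so 4 · regions ≤ 6n. As the cycle rank is at least 2n − 2, this forces n ≤ 4g + 2
(`SimpleGraph.EmbedsInGenus.card_le_of_spokes`).

Upper bound. Take 4g + 2 plane theta graphs, each with two ends and many subdivided paths ("pages"),
and glue midpoints of different copies on two pages only, by shifts in `ZMod (4 * g + 2)`. One of
these pages becomes two vertices, used for 0 and G, the other a single vertex, used for T. The ends
of a copy serve as A and p⁻¹A, and the unglued pages hold the middle subgroups. Vertices and faces
are counted by cosets, and the Euler characteristic is 2 − 2g (`ThetaDart.surface_hasGenus`).

Hence the graph embeds in genus g exactly when p + 1 ≤ 4g + 2. -/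

section Invariance

variable {D T : Type*} {q : D → T}

theorem apply_eq_of_mem_closure {s : Set (Equiv.Perm D)} (hs : ∀ σ ∈ s, ∀ d, q (σ d) = q d)
    {π : Equiv.Perm D} (hπ : π ∈ Subgroup.closure s) (d : D) : q (π d) = q d := by
  induction hπ using Subgroup.closure_induction generalizing d with
  | mem σ hσ => exact hs σ hσ d
  | one => rfl
  | mul σ τ _ _ hσ hτ => exact (hσ (τ d)).trans (hτ d)
  | inv σ _ hσ => simpa using (hσ (σ⁻¹ d)).symm

theorem Equiv.Perm.SameCycle.apply_eq {π : Equiv.Perm D} (hq : ∀ d, q (π d) = q d) {d e : D}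
    (h : π.SameCycle d e) : q d = q e := by
  obtain ⟨z, rfl⟩ := h
  exact (apply_eq_of_mem_closure (s := {π}) (by simpa using hq)
    (Subgroup.zpow_mem _ (Subgroup.subset_closure (Set.mem_singleton π)) z) d).symm

end Invariance

/-! ### Orbit counts as dimensions, and rank estimates -/

section InvariantFunctions

variable {D : Type*}

/-- The functions that are constant on the orbits of a permutation. -/
def invariantFunctions (π : Equiv.Perm D) : Submodule ℚ (D → ℚ) where
  carrier := {b | ∀ d, b (π d) = b d}
  add_mem' := by
    intro a b ha hb d
    simp [ha d, hb d]
  zero_mem' := by intro d; rfl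
  smul_mem' := by
    intro c a ha d
    simp [ha d]

/-- Invariant functions are the functions on the set of orbits. -/
def invariantFunctionsEquiv (π : Equiv.Perm D) :
    invariantFunctions π ≃ₗ[ℚ] (Quotient (Equiv.Perm.SameCycle.setoid π) → ℚ) where
  toFun b := Quotient.lift b.1 fun _ _ h => Equiv.Perm.SameCycle.apply_eq b.2 h
  invFun c := ⟨fun d => c (Quotient.mk _ d), fun d => congrArg c (Quotient.sound
    (show π.SameCycle (π d) d from (Equiv.Perm.SameCycle.refl π d).apply_left))⟩
  map_add' a b := by
    ext q; induction q using Quotient.inductionOn; rfl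
  map_smul' c b := by
    ext q; induction q using Quotient.inductionOn; rfl
  left_inv b := by ext d; rfl
  right_inv c := by
    ext q; induction q using Quotient.inductionOn; rfl

theorem finrank_invariantFunctions [Finite D] (π : Equiv.Perm D) :
    Module.finrank ℚ (invariantFunctions π) = numOrbits π := by
  have : Fintype (Quotient (Equiv.Perm.SameCycle.setoid π)) := Fintype.ofFinite _
  rw [(invariantFunctionsEquiv π).finrank_eq, Module.finrank_fintype_fun_eq_card, numOrbits,
    Nat.card_eq_fintype_card]

end InvariantFunctions

section Rank

variable {M N : Type*} [AddCommGroup M] [Module ℚ M] [AddCommGroup N] [Module ℚ N]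
  [FiniteDimensional ℚ M]

/-- Rank–nullity on `U`, whose part of the kernel lies in a line. It is applied to `jump`, where the
line is that of the constants. -/
theorem finrank_le_finrank_map_add_one (f : M →ₗ[ℚ] N) (U : Submodule ℚ M) (u : M)
    (h : ∀ x ∈ U, f x = 0 → ∃ c : ℚ, x = c • u) :
    Module.finrank ℚ U ≤ Module.finrank ℚ (U.map f) + 1 := by
  have h1 := LinearMap.finrank_range_add_finrank_ker (f.domRestrict U)
  rw [LinearMap.range_domRestrict] at h1
  have h2 : (LinearMap.ker (f.domRestrict U)).map U.subtype ≤ Submodule.span ℚ {u} := by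
    rintro _ ⟨x, hx, rfl⟩
    obtain ⟨c, hc⟩ := h x x.2 hx
    exact Submodule.mem_span_singleton.2 ⟨c, hc.symm⟩
  have h3 := (Submodule.finrank_mono h2).trans ((finrank_span_le_card {u}).trans (by simp : _ ≤ 1))
  rw [Submodule.finrank_map_subtype_eq] at h3
  omega

theorem finrank_map_add_one_le (f : M →ₗ[ℚ] N) (U : Submodule ℚ M) {u : M} (hu : u ∈ U)
    (hu0 : u ≠ 0) (hfu : f u = 0) :
    Module.finrank ℚ (U.map f) + 1 ≤ Module.finrank ℚ U := by
  have h1 := LinearMap.finrank_range_add_finrank_ker (f.domRestrict U)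
  rw [LinearMap.range_domRestrict] at h1
  have h2 : 0 < Module.finrank ℚ (LinearMap.ker (f.domRestrict U)) := by
    have : Nontrivial (LinearMap.ker (f.domRestrict U)) :=
      ⟨⟨⟨⟨u, hu⟩, hfu⟩, 0, fun h => hu0 (congrArg (fun x => (x.1 : M)) h)⟩⟩
    exact Module.finrank_pos
  omega

end Rank

/-! ### Rational chains on a cell surface and an Euler inequality -/

namespace CellSurface

variable (S : CellSurface)

instance : Finite S.Dart := S.finite_dart
instance : Nonempty S.Dart := S.nonempty_dart

noncomputable instance : Fintype S.Dart := Fintype.ofFinite _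

/-- The difference of the values of a dart function on the two sides of an edge. -/
def jump : (S.Dart → ℚ) →ₗ[ℚ] (S.Dart → ℚ) where
  toFun b d := b d - b (S.rev d)
  map_add' a b := by ext d; simp; ring
  map_smul' c b := by ext d; simp; ring

theorem jump_apply (b : S.Dart → ℚ) (d : S.Dart) : S.jump b d = b d - b (S.rev d) := rfl

/-- This is where the lower bound uses that the surface is connected. -/
theorem eq_const_of_invariant {b : S.Dart → ℚ} (h : ∀ d, b (S.rot d) = b d)
    (h' : ∀ d, b (S.rev d) = b d) (d e : S.Dart) : b d = b e := by
  obtain ⟨π, hπ, rfl⟩ := S.connected d e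
  refine (apply_eq_of_mem_closure ?_ hπ d).symm
  rintro τ (rfl | rfl)
  · exact h
  · exact h'

theorem rev_invariant_of_jump_eq_zero {b : S.Dart → ℚ} (h : S.jump b = 0) (d : S.Dart) :
    b (S.rev d) = b d := by
  have := congrFun h d
  rw [jump_apply, Pi.zero_apply] at this
  linarith

theorem rot_invariant_of_face_invariant {b : S.Dart → ℚ} (h : ∀ d, b ((S.rot * S.rev) d) = b d)
    (h' : ∀ d, b (S.rev d) = b d) (d : S.Dart) : b (S.rot d) = b d := by
  have := h (S.rev d)
  rw [Equiv.Perm.mul_apply, S.rev_rev, h'] at this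
  exact this

theorem exists_eq_smul_one {b : S.Dart → ℚ} (h : ∀ d e, b d = b e) : ∃ c : ℚ, b = c • 1 :=
  ⟨b (Classical.arbitrary _), by ext d; simp [h d (Classical.arbitrary _)]⟩

/-- The antisymmetric dart functions. -/
def chains : Submodule ℚ (S.Dart → ℚ) where
  carrier := {x | ∀ d, x (S.rev d) = - x d}
  add_mem' := by
    intro a b ha hb d
    simp only [Pi.add_apply, ha d, hb d]; ring
  zero_mem' := by intro d; simp
  smul_mem' := by
    intro c a ha d
    simp [ha d]

/-- The chains with zero boundary. -/
def cycles : Submodule ℚ (S.Dart → ℚ) where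
  carrier := {x | x ∈ S.chains ∧ ∀ a ∈ invariantFunctions S.rot, ∑ d, x d * a d = 0}
  add_mem' := by
    rintro x y ⟨hx, hx'⟩ ⟨hy, hy'⟩
    refine ⟨add_mem hx hy, fun a ha => ?_⟩
    simp only [Pi.add_apply, add_mul, Finset.sum_add_distrib, hx' a ha, hy' a ha, add_zero]
  zero_mem' := ⟨zero_mem _, by simp⟩
  smul_mem' := by
    rintro c x ⟨hx, hx'⟩
    refine ⟨Submodule.smul_mem _ _ hx, fun a ha => ?_⟩
    simp only [Pi.smul_apply, smul_eq_mul, mul_assoc, ← Finset.mul_sum, hx' a ha, mul_zero]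

theorem sum_comp_rev (f : S.Dart → ℚ) : ∑ d, f (S.rev d) = ∑ d, f d :=
  Equiv.sum_comp S.rev f

theorem jump_mem_chains (b : S.Dart → ℚ) : S.jump b ∈ S.chains := by
  intro d
  simp only [jump_apply, S.rev_rev]; ring

/-- Pairing an antisymmetric function with a jump. -/
theorem sum_mul_jump {x : S.Dart → ℚ} (hx : x ∈ S.chains) (a : S.Dart → ℚ) :
    ∑ d, x d * S.jump a d = 2 * ∑ d, x d * a d := by
  have h1 : ∑ d, x d * a (S.rev d) = - ∑ d, x d * a d := by
    rw [← S.sum_comp_rev fun d => x d * a (S.rev d), ← Finset.sum_neg_distrib]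
    refine Finset.sum_congr rfl fun d _ => ?_
    rw [S.rev_rev, hx d]; ring
  simp only [jump_apply, mul_sub, Finset.sum_sub_distrib, h1]; ring

/-- The boundary of a boundary vanishes: the face permutation sends `d` to the dart following `rev
d` around its origin, so reindexing by it matches the two halves of the sum. -/
theorem jump_mem_cycles {b : S.Dart → ℚ} (hb : b ∈ invariantFunctions (S.rot * S.rev)) :
    S.jump b ∈ S.cycles := by
  refine ⟨S.jump_mem_chains b, fun a ha => ?_⟩
  have h1 : ∑ d, b (S.rev d) * a d = ∑ d, b d * a d := by
    rw [← S.sum_comp_rev fun d => b (S.rev d) * a d,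
      ← Equiv.sum_comp (S.rot * S.rev) fun d => b d * a d]
    refine Finset.sum_congr rfl fun d _ => ?_
    rw [S.rev_rev, hb d, Equiv.Perm.mul_apply, ha]
  simp only [jump_apply, sub_mul, Finset.sum_sub_distrib, h1, sub_self]

-- Choosing a preferred direction for each edge gives a sign `s` that changes under reversal;
-- multiplication by `s` turns antisymmetric functions into functions on edges.
open Classical in
theorem finrank_chains_le : Module.finrank ℚ S.chains ≤ numOrbits S.rev := by
  rw [← finrank_invariantFunctions]
  let s : S.Dart → ℚ := fun d =>
    if (Quotient.mk (Equiv.Perm.SameCycle.setoid S.rev) d).out = d then 1 else -1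
  have hpow : ∀ d e, S.rev.SameCycle d e → e = d ∨ e = S.rev d := by
    intro d e h
    have hinv : ∀ x, S.rev.SameCycle d x → x = d ∨ x = S.rev d := by
      rintro x ⟨z, rfl⟩
      have h2 : S.rev ^ (2 : ℤ) = 1 := by
        ext y; simp [zpow_ofNat, pow_two, S.rev_rev]
      obtain ⟨k, rfl | rfl⟩ := Int.even_or_odd' z
      · left; rw [zpow_mul, h2, one_zpow]; rfl
      · right; rw [zpow_add, zpow_mul, h2, one_zpow, one_mul, zpow_one]
    exact hinv e h
  have hs : ∀ d, s (S.rev d) = - s d := by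
    intro d
    have hq : Quotient.mk (Equiv.Perm.SameCycle.setoid S.rev) (S.rev d)
        = Quotient.mk (Equiv.Perm.SameCycle.setoid S.rev) d :=
      Quotient.sound (show S.rev.SameCycle (S.rev d) d from
        (Equiv.Perm.SameCycle.refl S.rev d).apply_left)
    have ho := hpow d _ (Quotient.exact
      (Quotient.out_eq (Quotient.mk (Equiv.Perm.SameCycle.setoid S.rev) d)).symm :
        S.rev.SameCycle d _)
    simp only [s, hq]
    rcases ho with ho | ho
    · rw [ho, if_neg (S.rev_ne d).symm, if_pos rfl]
    · rw [ho, if_pos rfl, if_neg (S.rev_ne d), neg_neg]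
  have hs0 : ∀ d, s d ≠ 0 := by
    intro d
    simp only [s]
    split_ifs <;> norm_num
  let f : S.chains →ₗ[ℚ] invariantFunctions S.rev :=
    { toFun := fun x => ⟨fun d => s d * x.1 d, fun d => by
        change s (S.rev d) * x.1 (S.rev d) = s d * x.1 d
        rw [hs, x.2 d]; ring⟩
      map_add' := fun x y => by ext d; simp [mul_add]
      map_smul' := fun c x => by ext d; simp; ring }
  refine LinearMap.finrank_le_finrank_of_injective (f := f) fun x y h => ?_
  ext d
  have := congrFun (congrArg Subtype.val h) d
  exact mul_left_cancel₀ (hs0 d) this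

/-- Cycles are orthogonal to the coboundaries of vertex functions. Both lie in the space of chains,
of dimension at most E, and the coboundaries have dimension at least V − 1. -/
theorem finrank_cycles_add_le :
    Module.finrank ℚ S.cycles + numOrbits S.rot ≤ numOrbits S.rev + 1 := by
  have h1 : numOrbits S.rot ≤
      Module.finrank ℚ ((invariantFunctions S.rot).map S.jump) + 1 := by
    rw [← finrank_invariantFunctions]
    refine finrank_le_finrank_map_add_one _ _ 1 fun b hb h => S.exists_eq_smul_one ?_
    exact S.eq_const_of_invariant hb (S.rev_invariant_of_jump_eq_zero h)
  have hdisj : Disjoint S.cycles ((invariantFunctions S.rot).map S.jump) := by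
    rw [Submodule.disjoint_def]
    rintro _ hx ⟨a, ha, rfl⟩
    have h0 : ∑ d, S.jump a d * S.jump a d = 0 := by
      rw [S.sum_mul_jump hx.1, hx.2 a ha, mul_zero]
    rw [Finset.sum_eq_zero_iff_of_nonneg fun d _ => mul_self_nonneg _] at h0
    ext d
    exact mul_self_eq_zero.1 (h0 d (Finset.mem_univ d))
  have hle : S.cycles ⊔ (invariantFunctions S.rot).map S.jump ≤ S.chains := by
    refine sup_le (fun x hx => hx.1) ?_
    rintro _ ⟨a, -, rfl⟩
    exact S.jump_mem_chains a
  have h2 := Submodule.finrank_sup_add_finrank_inf_eq S.cycles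
    ((invariantFunctions S.rot).map S.jump)
  rw [hdisj.eq_bot, finrank_bot, add_zero] at h2
  have h3 := Submodule.finrank_mono hle
  have h4 := S.finrank_chains_le
  omega

/-- The cycles supported on a set of darts. -/
def cyclesOn (H : Set S.Dart) : Submodule ℚ (S.Dart → ℚ) where
  carrier := {x | x ∈ S.cycles ∧ ∀ d ∉ H, x d = 0}
  add_mem' := by
    rintro x y ⟨hx, hx'⟩ ⟨hy, hy'⟩
    exact ⟨add_mem hx hy, fun d hd => by simp [hx' d hd, hy' d hd]⟩
  zero_mem' := ⟨zero_mem _, fun _ _ => rfl⟩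
  smul_mem' := by
    rintro c x ⟨hx, hx'⟩
    exact ⟨Submodule.smul_mem _ _ hx, fun d hd => by simp [hx' d hd]⟩

/-- The functions that are constant on each region into which the darts in `H` divide the
surface. -/
def regionFunctions (H : Set S.Dart) : Submodule ℚ (S.Dart → ℚ) where
  carrier := {b | b ∈ invariantFunctions (S.rot * S.rev) ∧ ∀ d ∉ H, S.jump b d = 0}
  add_mem' := by
    rintro x y ⟨hx, hx'⟩ ⟨hy, hy'⟩
    exact ⟨add_mem hx hy, fun d hd => by simp [hx' d hd, hy' d hd]⟩
  zero_mem' := ⟨zero_mem _, fun _ _ => by simp⟩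
  smul_mem' := by
    rintro c x ⟨hx, hx'⟩
    exact ⟨Submodule.smul_mem _ _ hx, fun d hd => by simp [hx' d hd]⟩

/-- Let B be the space of boundaries of face functions, of dimension at least F − 1. Inside the
cycles, of dimension at most E − V + 1, the space B meets `cyclesOn H` only in boundaries of region
functions, and these lose one dimension to the constants. The dimension formula and V − E + F = 2 −
2g give the bound. -/
theorem finrank_cyclesOn_add_one_le {g : ℕ} (hg : S.HasGenus g) (H : Set S.Dart) :
    Module.finrank ℚ (S.cyclesOn H) + 1 ≤ Module.finrank ℚ (S.regionFunctions H) + 2 * g := by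
  set B := (invariantFunctions (S.rot * S.rev)).map S.jump with hB
  have h1 : numOrbits (S.rot * S.rev) ≤ Module.finrank ℚ B + 1 := by
    rw [← finrank_invariantFunctions]
    refine finrank_le_finrank_map_add_one _ _ 1 fun b hb h => S.exists_eq_smul_one ?_
    have h' := S.rev_invariant_of_jump_eq_zero h
    exact S.eq_const_of_invariant (S.rot_invariant_of_face_invariant hb h') h'
  have h2 : Module.finrank ℚ ((S.regionFunctions H).map S.jump) + 1
      ≤ Module.finrank ℚ (S.regionFunctions H) := by
    refine finrank_map_add_one_le _ _ (u := 1) ⟨fun d => rfl, fun d _ => ?_⟩ ?_ ?_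
    · simp [jump_apply]
    · exact one_ne_zero
    · ext d; simp [jump_apply]
  have h3 : S.cyclesOn H ⊓ B ≤ (S.regionFunctions H).map S.jump := by
    rintro _ ⟨hx, b, hb, rfl⟩
    exact ⟨b, ⟨hb, hx.2⟩, rfl⟩
  have h4 : S.cyclesOn H ⊔ B ≤ S.cycles := by
    refine sup_le (fun x hx => hx.1) ?_
    rintro _ ⟨b, hb, rfl⟩
    exact S.jump_mem_cycles hb
  have h5 := Submodule.finrank_sup_add_finrank_inf_eq (S.cyclesOn H) B
  have h6 := Submodule.finrank_mono h3
  have h7 := Submodule.finrank_mono h4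
  have h8 := S.finrank_cycles_add_le
  unfold HasGenus eulerChar at hg
  omega

/-- The regions into which the darts in `H` divide the surface, as an equivalence relation on
darts. -/
def regionSetoid (H : Set S.Dart) : Setoid S.Dart where
  r d e := ∀ b ∈ S.regionFunctions H, b d = b e
  iseqv := ⟨fun _ _ _ => rfl, fun h b hb => (h b hb).symm,
    fun h h' b hb => (h b hb).trans (h' b hb)⟩

theorem finrank_regionFunctions_le (H : Set S.Dart) :
    Module.finrank ℚ (S.regionFunctions H) ≤ Nat.card (Quotient (S.regionSetoid H)) := by
  have : Fintype (Quotient (S.regionSetoid H)) := Fintype.ofFinite _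
  rw [Nat.card_eq_fintype_card, ← Module.finrank_fintype_fun_eq_card ℚ]
  let f : S.regionFunctions H →ₗ[ℚ] (Quotient (S.regionSetoid H) → ℚ) :=
    { toFun := fun b => Quotient.lift b.1 fun _ _ h => h b b.2
      map_add' := fun a b => by
        ext q; induction q using Quotient.inductionOn; rfl
      map_smul' := fun c b => by
        ext q; induction q using Quotient.inductionOn; rfl }
  refine LinearMap.finrank_le_finrank_of_injective (f := f) fun x y h => ?_
  ext d
  exact congrFun h (Quotient.mk _ d)

open Classical in
/-- The indicator function of a region. -/
noncomputable def regionIndicator (H : Set S.Dart) (t : Quotient (S.regionSetoid H)) :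
    S.Dart → ℚ :=
  fun d => if Quotient.mk (S.regionSetoid H) d = t then 1 else 0

theorem regionIndicator_mem (H : Set S.Dart) (t : Quotient (S.regionSetoid H)) :
    S.regionIndicator H t ∈ S.regionFunctions H := by
  refine ⟨fun d => ?_, fun d hd => ?_⟩
  · have : Quotient.mk (S.regionSetoid H) ((S.rot * S.rev) d) = Quotient.mk _ d :=
      Quotient.sound fun b hb => hb.1 d
    rw [regionIndicator, this, regionIndicator]
  · have : Quotient.mk (S.regionSetoid H) (S.rev d) = Quotient.mk _ d :=
      Quotient.sound fun b hb => by
        have := hb.2 d hd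
        rw [jump_apply] at this
        linarith
    rw [jump_apply, regionIndicator, regionIndicator, this, sub_self]

open Classical in
/-- If each nonzero cycle on `H` uses at least `k` of the edges in `E`, counting the
sides of edges bounds the number of regions. -/
theorem mul_card_regions_le (H : Set S.Dart) (E : Finset S.Dart) (k : ℕ)
    (hE : ∀ x ∈ S.cyclesOn H, x ≠ 0 → k ≤ (E.filter fun e => x e ≠ 0).card)
    (hr : 2 ≤ Nat.card (Quotient (S.regionSetoid H))) :
    k * Nat.card (Quotient (S.regionSetoid H)) ≤ 2 * E.card := by
  have : Fintype (Quotient (S.regionSetoid H)) := Fintype.ofFinite _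
  rw [Nat.card_eq_fintype_card] at hr ⊢
  have h1 : ∀ t : Quotient (S.regionSetoid H),
      k ≤ (E.filter fun e => S.jump (S.regionIndicator H t) e ≠ 0).card := by
    intro t
    have ht := S.regionIndicator_mem H t
    -- The boundary of a region is a cycle on `H`. If it vanished, the indicator would be constant,
    -- contradicting the presence of a second region.
    refine hE _ ⟨S.jump_mem_cycles ht.1, ht.2⟩ fun h0 => ?_
    have h' := S.rev_invariant_of_jump_eq_zero h0
    have hc := S.eq_const_of_invariant (S.rot_invariant_of_face_invariant ht.1 h') h'
    obtain ⟨t', ht'⟩ : ∃ t', t' ≠ t := by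
      have : Nontrivial (Quotient (S.regionSetoid H)) := Fintype.one_lt_card_iff_nontrivial.1 hr
      exact exists_ne t
    have := hc t.out t'.out
    simp [regionIndicator, ht'] at this
  calc k * Fintype.card (Quotient (S.regionSetoid H))
      = ∑ _t : Quotient (S.regionSetoid H), k := by simp [mul_comm]
    _ ≤ ∑ t : Quotient (S.regionSetoid H),
          (E.filter fun e => S.jump (S.regionIndicator H t) e ≠ 0).card :=
        Finset.sum_le_sum fun t _ => h1 t
    _ = ∑ e ∈ E, (Finset.univ.filter fun t => S.jump (S.regionIndicator H t) e ≠ 0).card := by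
        simp only [Finset.card_filter]
        exact Finset.sum_comm
    _ ≤ ∑ _e ∈ E, 2 := by
        refine Finset.sum_le_sum fun e _ => ?_
        -- Only the regions on the two sides of `e` can have `e` in their boundary.
        refine (Finset.card_le_card (t := {Quotient.mk _ e, Quotient.mk _ (S.rev e)})
          fun t ht => ?_).trans Finset.card_le_two
        by_contra hne
        simp only [Finset.mem_insert, Finset.mem_singleton, not_or] at hne
        refine (Finset.mem_filter.1 ht).2 ?_
        rw [jump_apply, regionIndicator, regionIndicator, if_neg (Ne.symm hne.1),
          if_neg (Ne.symm hne.2), sub_self]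
    _ = 2 * E.card := by simp [mul_comm]

end CellSurface

/-! ### Flows of an embedded graph as cycles on the surface -/

section Flows

variable {J W : Type*} [Fintype J]

/-- The rational flows without sources and sinks on a directed graph with edge set `J`. -/
def flows (tail head : J → W) : Submodule ℚ (J → ℚ) where
  carrier := {y | ∀ a : W → ℚ, ∑ j, y j * (a (head j) - a (tail j)) = 0}
  add_mem' := by
    intro x y hx hy a
    simp only [Pi.add_apply, add_mul, Finset.sum_add_distrib, hx a, hy a, add_zero]
  zero_mem' := by intro a; simp
  smul_mem' := by
    intro c x hx a
    simp only [Pi.smul_apply, smul_eq_mul, mul_assoc, ← Finset.mul_sum, hx a, mul_zero]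

variable {S : CellSurface}

open Classical in
/-- The antisymmetric dart function of a weighted sum of darts. -/
noncomputable def dartChain (δ : J → S.Dart) : (J → ℚ) →ₗ[ℚ] (S.Dart → ℚ) where
  toFun y d := ∑ j, y j * ((if d = δ j then 1 else 0) - (if d = S.rev (δ j) then 1 else 0))
  map_add' x y := by
    ext d
    simp only [Pi.add_apply, add_mul, Finset.sum_add_distrib]
  map_smul' c x := by
    ext d
    simp only [Pi.smul_apply, smul_eq_mul, mul_assoc, ← Finset.mul_sum, RingHom.id_apply]

theorem dartChain_mem_chains (δ : J → S.Dart) (y : J → ℚ) : dartChain δ y ∈ S.chains := by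
  classical
  intro d
  simp only [dartChain, LinearMap.coe_mk, AddHom.coe_mk, ← Finset.sum_neg_distrib]
  refine Finset.sum_congr rfl fun j _ => ?_
  have h1 : S.rev d = δ j ↔ d = S.rev (δ j) :=
    ⟨fun h => by rw [← h, S.rev_rev], fun h => by rw [h, S.rev_rev]⟩
  simp only [h1, S.rev.injective.eq_iff]
  ring

theorem sum_dartChain_mul (δ : J → S.Dart) (y : J → ℚ) (a : S.Dart → ℚ) :
    ∑ d, dartChain δ y d * a d = ∑ j, y j * (a (δ j) - a (S.rev (δ j))) := by
  classical
  simp only [dartChain, LinearMap.coe_mk, AddHom.coe_mk, Finset.sum_mul]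
  rw [Finset.sum_comm]
  refine Finset.sum_congr rfl fun j _ => ?_
  simp only [mul_assoc, ← Finset.mul_sum, sub_mul, Finset.sum_sub_distrib, ite_mul, one_mul,
    zero_mul, Finset.sum_ite_eq', Finset.mem_univ, if_true]

theorem dartChain_apply {δ : J → S.Dart} (h1 : Function.Injective δ)
    (h2 : ∀ i j, δ i ≠ S.rev (δ j)) (y : J → ℚ) (j : J) : dartChain δ y (δ j) = y j := by
  classical
  simp only [dartChain, LinearMap.coe_mk, AddHom.coe_mk, h1.eq_iff, if_neg (h2 _ _), sub_zero,
    mul_ite, mul_one, mul_zero, Finset.sum_ite_eq, Finset.mem_univ, if_true]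

theorem dartChain_apply_of_ne {δ : J → S.Dart} (y : J → ℚ) {d : S.Dart}
    (h1 : ∀ j, d ≠ δ j) (h2 : ∀ j, d ≠ S.rev (δ j)) : dartChain δ y d = 0 := by
  classical
  simp [dartChain, h1, h2]

/-- An Euler type bound for graphs on a surface of genus `g`: if each nonzero flow uses
at least `k` edges from `E`, then the cycle rank is bounded in terms of `g`, `k` and `E`. -/
theorem SimpleGraph.EmbedsInGenus.finrank_flows_le {V : Type*} {Γ : SimpleGraph V} {g : ℕ}
    (hΓ : Γ.EmbedsInGenus g) {tail head : J → W} (φ : W → V) (hφ : Function.Injective φ)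
    (hadj : ∀ j, Γ.Adj (φ (tail j)) (φ (head j)))
    (hinj : ∀ i j, tail i = tail j → head i = head j → i = j)
    (hne : ∀ i j, tail i = head j → head i ≠ tail j) (E : Finset J) (k : ℕ)
    (hE : ∀ y ∈ flows tail head, y ≠ 0 → k ≤ (E.filter fun e => y e ≠ 0).card) :
    Module.finrank ℚ (flows tail head) ≤ 2 * g ∨
      k * (Module.finrank ℚ (flows tail head) + 1) ≤ 2 * E.card + k * (2 * g) := by
  classical
  obtain ⟨S, hg, f, hf, hd⟩ := hΓ
  choose δ hδ hδ' using fun j => hd _ _ (hadj j)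
  have h1 : Function.Injective δ := by
    intro i j h
    refine hinj i j (hφ (hf ?_)) (hφ (hf ?_))
    · rw [← hδ, ← hδ, h]
    · rw [← hδ', ← hδ', h]
  have h2 : ∀ i j, δ i ≠ S.rev (δ j) := by
    intro i j h
    refine hne i j (hφ (hf ?_)) (hφ (hf ?_))
    · rw [← hδ, ← hδ', h]
    · rw [← hδ, ← hδ', h, S.rev_rev]
  -- Only the darts of the chosen edges separate regions; every other edge of the 1-skeleton is
  -- ignored.
  let H : Set S.Dart := {d | ∃ j, d = δ j ∨ d = S.rev (δ j)}
  have hrank : Module.finrank ℚ (flows tail head) ≤ Module.finrank ℚ (S.cyclesOn H) := by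
    have hmem : ∀ y : flows tail head, dartChain δ y.1 ∈ S.cyclesOn H := by
      rintro ⟨y, hy⟩
      refine ⟨⟨dartChain_mem_chains δ y, fun a ha => ?_⟩, fun d hd => ?_⟩
      · rw [sum_dartChain_mul]
        let b : S.Vertex → ℚ := Quotient.lift a fun _ _ h => Equiv.Perm.SameCycle.apply_eq ha h
        have hb : ∀ d, a d = b (S.origin d) := fun d => rfl
        have := hy fun v => b (f (φ v))
        simp only [hb, hδ, hδ']
        rw [← neg_eq_zero, ← Finset.sum_neg_distrib, ← this]
        exact Finset.sum_congr rfl fun j _ => by ring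
      · exact dartChain_apply_of_ne y (fun j h => hd ⟨j, Or.inl h⟩)
          fun j h => hd ⟨j, Or.inr h⟩
    refine LinearMap.finrank_le_finrank_of_injective
      (f := ((dartChain δ).comp (flows tail head).subtype).codRestrict (S.cyclesOn H) hmem)
      fun x y h => ?_
    ext j
    have : dartChain δ x.1 (δ j) = dartChain δ y.1 (δ j) :=
      congrFun (congrArg Subtype.val h) (δ j)
    rwa [dartChain_apply h1 h2, dartChain_apply h1 h2] at this
  have hback : ∀ x ∈ S.cyclesOn H, x = dartChain δ fun j => x (δ j) := by
    intro x hx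
    ext d
    by_cases hdH : d ∈ H
    · obtain ⟨j, rfl | rfl⟩ := hdH
      · rw [dartChain_apply h1 h2]
      · rw [hx.1.1, dartChain_mem_chains, dartChain_apply h1 h2]
    · rw [hx.2 d hdH, dartChain_apply_of_ne]
      · exact fun j h => hdH ⟨j, Or.inl h⟩
      · exact fun j h => hdH ⟨j, Or.inr h⟩
  have hE' : ∀ x ∈ S.cyclesOn H, x ≠ 0 →
      k ≤ ((E.image δ).filter fun e => x e ≠ 0).card := by
    intro x hx hx0
    rw [Finset.filter_image, Finset.card_image_of_injective _ h1]
    refine hE (fun j => x (δ j)) (fun a => ?_) fun h0 => ?_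
    -- The potential is extended by 0 to the remaining vertices of the surface; only its values at
    -- the images of `W` enter the sum.
    · let b : S.Vertex → ℚ := Function.extend (f ∘ φ) a 0
      have hb : ∀ w, b (f (φ w)) = a w := fun w => (hf.comp hφ).extend_apply a 0 w
      have hbm : (fun d => b (S.origin d)) ∈ invariantFunctions S.rot := by
        intro d
        exact congrArg b (Quotient.sound (show S.rot.SameCycle (S.rot d) d from
          (Equiv.Perm.SameCycle.refl S.rot d).apply_left))
      have := hx.1.2 _ hbm
      rw [hback x hx, sum_dartChain_mul] at this
      rw [← neg_eq_zero, ← Finset.sum_neg_distrib, ← this]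
      refine Finset.sum_congr rfl fun j _ => ?_
      rw [hδ, hδ', hb, hb]; ring
    · apply hx0
      rw [hback x hx, h0, map_zero]
  have hr := S.finrank_cyclesOn_add_one_le hg H
  have hr' := S.finrank_regionFunctions_le H
  rcases lt_or_ge (Nat.card (Quotient (S.regionSetoid H))) 2 with hlt | hge
  -- With at most one region the Euler inequality alone suffices, and region boundaries may vanish.
  · left; omega
  · right
    have h3 := S.mul_card_regions_le H (E.image δ) k hE' hge
    rw [Finset.card_image_of_injective _ h1] at h3
    calc k * (Module.finrank ℚ (flows tail head) + 1)
        ≤ k * (Nat.card (Quotient (S.regionSetoid H)) + 2 * g) :=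
          Nat.mul_le_mul_left k (by omega)
      _ ≤ 2 * E.card + k * (2 * g) := by rw [mul_add]; omega

end Flows

/-! ### Lower bound for a subdivided complete bipartite graph -/

/-- A nonzero matrix with zero row and column sums has at least four nonzero entries. -/
theorem four_le_card_support {κ ι : Type*} [Fintype ι] [DecidableEq κ] [DecidableEq ι]
    (K : Finset κ) (w : κ × ι → ℚ) (hrow : ∀ k ∈ K, ∑ i, w (k, i) = 0)
    (hcol : ∀ i, ∑ k ∈ K, w (k, i) = 0) {k : κ} (hk : k ∈ K) {i : ι} (h : w (k, i) ≠ 0) :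
    4 ≤ ((K ×ˢ Finset.univ).filter fun e => w e ≠ 0).card := by
  have hrow' : ∀ k ∈ K, ∀ i, w (k, i) ≠ 0 → ∃ i', i' ≠ i ∧ w (k, i') ≠ 0 := by
    intro k hk i h
    by_contra! hc
    exact h ((Finset.sum_eq_single i (fun i' _ hi' => hc i' hi') (by simp)).symm.trans
      (hrow k hk))
  obtain ⟨k', hk', hkk', h'⟩ : ∃ k' ∈ K, k' ≠ k ∧ w (k', i) ≠ 0 := by
    by_contra! hc
    exact h ((Finset.sum_eq_single k hc (fun hn => absurd hk hn)).symm.trans (hcol i))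
  obtain ⟨i₁, hi₁, h₁⟩ := hrow' k hk i h
  obtain ⟨i₂, hi₂, h₂⟩ := hrow' k' hk' i h'
  have hcard : ({(k, i), (k, i₁), (k', i), (k', i₂)} : Finset (κ × ι)).card = 4 := by
    rw [Finset.card_insert_of_notMem, Finset.card_insert_of_notMem,
      Finset.card_insert_of_notMem, Finset.card_singleton]
    · simp [hi₂.symm]
    · simp [hkk'.symm]
    · simp [hkk'.symm, hi₁.symm]
  rw [← hcard]
  refine Finset.card_le_card ?_
  intro e he
  simp only [Finset.mem_insert, Finset.mem_singleton] at he
  rcases he with rfl | rfl | rfl | rfl <;> simp [*]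

/-- The vertices of a graph consisting of three hubs `bot`, `mid`, `top` and of paths
`atom i`, `cyc i`, `coatom i`. -/
inductive SpokeVertex (ι : Type*)
  | bot
  | mid
  | top
  | atom (i : ι)
  | cyc (i : ι)
  | coatom (i : ι)

namespace SpokeVertex

variable {ι : Type*}

/-- The tails of the edges of a subdivision of the complete bipartite graph with parts the three
hubs and the atoms. -/
def tail (e : Fin 5 × ι) : SpokeVertex ι := ![bot, mid, cyc e.2, coatom e.2, top] e.1

/-- The heads of the edges of a subdivision of the complete bipartite graph with parts the three
hubs and the atoms. -/
def head (e : Fin 5 × ι) : SpokeVertex ι :=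
  ![atom e.2, atom e.2, atom e.2, cyc e.2, coatom e.2] e.1

theorem mem_flows_iff [Fintype ι] (y : Fin 5 × ι → ℚ) : y ∈ flows (tail (ι := ι)) head ↔
    ∀ a : SpokeVertex ι → ℚ, ∑ i, (y (0, i) * (a (atom i) - a bot)
      + y (1, i) * (a (atom i) - a mid) + y (2, i) * (a (atom i) - a (cyc i))
      + y (3, i) * (a (cyc i) - a (coatom i)) + y (4, i) * (a (coatom i) - a top)) = 0 := by
  refine forall_congr' fun a => ?_
  rw [Fintype.sum_prod_type_right]
  simp [Fin.sum_univ_five, tail, head]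

theorem flow_atom [Fintype ι] {y : Fin 5 × ι → ℚ} (hy : y ∈ flows (tail (ι := ι)) head) (i : ι) :
    y (0, i) + y (1, i) + y (2, i) = 0 := by
  classical
  have := (mem_flows_iff y).1 hy fun v => match v with
    | atom j => if j = i then 1 else 0
    | _ => 0
  simpa [Finset.sum_add_distrib] using this

theorem flow_cyc [Fintype ι] {y : Fin 5 × ι → ℚ} (hy : y ∈ flows (tail (ι := ι)) head) (i : ι) :
    y (3, i) = y (2, i) := by
  classical
  have := (mem_flows_iff y).1 hy fun v => match v with
    | cyc j => if j = i then 1 else 0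
    | _ => 0
  simp [Finset.sum_add_distrib] at this
  linarith

theorem flow_coatom [Fintype ι] {y : Fin 5 × ι → ℚ} (hy : y ∈ flows (tail (ι := ι)) head)
    (i : ι) : y (4, i) = y (3, i) := by
  classical
  have := (mem_flows_iff y).1 hy fun v => match v with
    | coatom j => if j = i then 1 else 0
    | _ => 0
  simp [Finset.sum_add_distrib] at this
  linarith

theorem flow_bot [Fintype ι] {y : Fin 5 × ι → ℚ} (hy : y ∈ flows (tail (ι := ι)) head) :
    ∑ i, y (0, i) = 0 := by
  have := (mem_flows_iff y).1 hy fun v => match v with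
    | bot => 1
    | _ => 0
  simpa [Finset.sum_add_distrib] using this

theorem flow_mid [Fintype ι] {y : Fin 5 × ι → ℚ} (hy : y ∈ flows (tail (ι := ι)) head) :
    ∑ i, y (1, i) = 0 := by
  have := (mem_flows_iff y).1 hy fun v => match v with
    | mid => 1
    | _ => 0
  simpa [Finset.sum_add_distrib] using this

theorem flow_top [Fintype ι] {y : Fin 5 × ι → ℚ} (hy : y ∈ flows (tail (ι := ι)) head) :
    ∑ i, y (4, i) = 0 := by
  have := (mem_flows_iff y).1 hy fun v => match v with
    | top => 1
    | _ => 0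
  simpa [Finset.sum_add_distrib] using this

/-- A flow is constant along each path atom–cyc–coatom–top, so edge class 2 represents the whole
path. The classes 0, 1, 2 then form a matrix with zero row and column sums: the girth of K_{3,n} is
4. -/
theorem four_le_card_flow [Fintype ι] {y : Fin 5 × ι → ℚ}
    (hy : y ∈ flows (tail (ι := ι)) head) (hy0 : y ≠ 0) [DecidableEq ι] :
    4 ≤ (((({0, 1, 2} : Finset (Fin 5)) ×ˢ (Finset.univ : Finset ι))).filter
      fun e => y e ≠ 0).card := by
  have hex : ∃ k ∈ ({0, 1, 2} : Finset (Fin 5)), ∃ i, y (k, i) ≠ 0 := by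
    by_contra! hc
    apply hy0
    ext ⟨j, i⟩
    have h0 := hc 0 (by decide) i
    have h1 := hc 1 (by decide) i
    have h2 := hc 2 (by decide) i
    have h3 := flow_cyc hy i
    have h4 := flow_coatom hy i
    fin_cases j <;> simp [*]
  obtain ⟨k, hk, i, h⟩ := hex
  refine four_le_card_support _ y ?_ ?_ hk h
  · intro k hk
    simp only [Finset.mem_insert, Finset.mem_singleton] at hk
    rcases hk with rfl | rfl | rfl
    · exact flow_bot hy
    · exact flow_mid hy
    · rw [← flow_top hy]
      exact Finset.sum_congr rfl fun i _ => by rw [flow_coatom hy, flow_cyc hy]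
  · intro i
    rw [Finset.sum_insert (by decide), Finset.sum_insert (by decide), Finset.sum_singleton,
      ← add_assoc, flow_atom hy]

/-- The flows out of `bot` and `mid` may be any two vectors with sum zero; conservation at the atoms
then fixes the flow along the third path. -/
theorem le_finrank_flows [Fintype ι] :
    2 * Fintype.card ι ≤ Module.finrank ℚ (flows (tail (ι := ι)) head) + 2 := by
  let σ : (ι → ℚ) →ₗ[ℚ] ℚ := ∑ i, LinearMap.proj i
  have hσ : ∀ u, σ u = ∑ i, u i := fun u => by simp [σ]
  have h1 : Fintype.card ι ≤ Module.finrank ℚ (LinearMap.ker σ) + 1 := by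
    have h2 := LinearMap.finrank_range_add_finrank_ker σ
    have h3 := Submodule.finrank_le (LinearMap.range σ)
    rw [Module.finrank_fintype_fun_eq_card] at h2
    rw [Module.finrank_self] at h3
    omega
  let L : (LinearMap.ker σ × LinearMap.ker σ) →ₗ[ℚ] flows (tail (ι := ι)) head :=
    { toFun := fun u => ⟨fun e => ![u.1.1 e.2, u.2.1 e.2, - u.1.1 e.2 - u.2.1 e.2,
          - u.1.1 e.2 - u.2.1 e.2, - u.1.1 e.2 - u.2.1 e.2] e.1, by
        rw [mem_flows_iff]
        intro a
        have e1 : ∑ i, u.1.1 i = 0 := by rw [← hσ]; exact u.1.2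
        have e2 : ∑ i, u.2.1 i = 0 := by rw [← hσ]; exact u.2.2
        calc _ = ∑ i, (u.1.1 i * (a top - a bot) + u.2.1 i * (a top - a mid)) := by
              refine Finset.sum_congr rfl fun i _ => ?_
              simp; ring
          _ = 0 := by
              rw [Finset.sum_add_distrib, ← Finset.sum_mul, ← Finset.sum_mul, e1, e2]; ring⟩
      map_add' := fun u v => by
        ext ⟨j, i⟩
        fin_cases j <;> simp <;> ring
      map_smul' := fun c u => by
        ext ⟨j, i⟩
        fin_cases j <;> simp <;> ring }
  have h2 : Function.Injective L := by
    intro u v h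
    ext i
    · exact congrFun (congrArg Subtype.val h) (0, i)
    · exact congrFun (congrArg Subtype.val h) (1, i)
  have h3 := LinearMap.finrank_le_finrank_of_injective h2
  rw [Module.finrank_prod] at h3
  omega

end SpokeVertex

/-- A graph containing a subdivision of the complete bipartite graph with parts of sizes `3` and
`n` has genus at least `(n - 2) / 4`. -/
theorem SimpleGraph.EmbedsInGenus.card_le_of_spokes {V ι : Type*} [Fintype ι]
    {Γ : SimpleGraph V} {g : ℕ} (hΓ : Γ.EmbedsInGenus g) (φ : SpokeVertex ι → V)
    (hφ : Function.Injective φ)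
    (hadj : ∀ j, Γ.Adj (φ (SpokeVertex.tail j)) (φ (SpokeVertex.head j))) :
    Fintype.card ι ≤ 4 * g + 2 := by
  classical
  have h := hΓ.finrank_flows_le φ hφ hadj ?_ ?_ _ 4 fun y hy hy0 =>
    SpokeVertex.four_le_card_flow hy hy0
  · rw [Finset.card_product, Finset.card_univ] at h
    have h1 : (({0, 1, 2} : Finset (Fin 5))).card = 3 := by decide
    -- With n = `Fintype.card ι` the second alternative becomes 4(2n − 1) ≤ 6n + 8g; the first, 2n −
    -- 2 ≤ 2g, is stronger than needed.
    have h2 := SpokeVertex.le_finrank_flows (ι := ι)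
    rw [h1] at h
    omega
  · rintro ⟨i, x⟩ ⟨j, y⟩
    fin_cases i <;> fin_cases j <;> simp [SpokeVertex.tail, SpokeVertex.head]
  · rintro ⟨i, x⟩ ⟨j, y⟩
    fin_cases i <;> fin_cases j <;> simp [SpokeVertex.tail, SpokeVertex.head]

/-! ### Theta graphs glued along their midpoints: vertices and faces -/

/-- Orbits are counted by a complete invariant with a section. -/
theorem numOrbits_eq_card {D T : Type*} {π : Equiv.Perm D} (q : D → T) (r : T → D)
    (hq : ∀ d, q (π d) = q d) (hqr : ∀ t, q (r t) = t) (hr : ∀ d, π.SameCycle (r (q d)) d) :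
    numOrbits π = Nat.card T := by
  refine Nat.card_congr
    { toFun := Quotient.lift q fun _ _ h => Equiv.Perm.SameCycle.apply_eq hq h
      invFun := fun t => Quotient.mk _ (r t)
      left_inv := fun t => ?_
      right_inv := hqr }
  induction t using Quotient.inductionOn with
  | h d => exact Quotient.sound (hr d)

theorem Equiv.Perm.SameCycle.add_zsmul {D A : Type*} [AddCommGroup A] {π : Equiv.Perm D}
    {f : A → D} {τ : A} (h : ∀ i, π.SameCycle (f i) (f (i + τ))) (i : A) (z : ℤ) :
    π.SameCycle (f i) (f (i + z • τ)) := by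
  induction z with
  | zero => simpa using Equiv.Perm.SameCycle.refl π (f i)
  | succ n ih =>
    refine ih.trans ?_
    have := h (i + (n : ℤ) • τ)
    rwa [add_assoc, ← add_one_zsmul] at this
  | pred n ih =>
    refine ih.trans ?_
    have := h (i + (-(n : ℤ) - 1) • τ)
    rw [add_assoc, ← add_one_zsmul, sub_add_cancel] at this
    exact this.symm

theorem Equiv.Perm.SameCycle.of_sub_mem_zmultiples {D A : Type*} [AddCommGroup A]
    {π : Equiv.Perm D} {f : A → D} {τ : A} (h : ∀ i, π.SameCycle (f i) (f (i + τ))) {i j : A}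
    (hij : (QuotientAddGroup.mk i : A ⧸ AddSubgroup.zmultiples τ) = QuotientAddGroup.mk j) :
    π.SameCycle (f i) (f j) := by
  rw [QuotientAddGroup.eq] at hij
  obtain ⟨z, hz⟩ := hij
  have := Equiv.Perm.SameCycle.add_zsmul h i z
  have hz' : z • τ = -i + j := hz
  rwa [hz', add_neg_cancel_left] at this

theorem sameCycle_self_apply {D : Type*} (π : Equiv.Perm D) (d : D) : π.SameCycle d (π d) :=
  (Equiv.Perm.SameCycle.refl π d).apply_right

/-- The darts of a surface built from copies, indexed by `A`, of a theta graph with edges indexed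
by `K`. The edge `k` of copy `i` is subdivided; `left` and `right` darts start from the end vertices,
`midLeft` and `midRight` darts start from the midpoint. The midpoints of distinct copies may
be identified with one another. -/
inductive ThetaDart (A K : Type)
  | left (i : A) (k : K)
  | right (i : A) (k : K)
  | midLeft (i : A) (k : K)
  | midRight (i : A) (k : K)

namespace ThetaDart

variable {A K : Type}

/-- A dart is given by its indices and two bits. -/
def equivProd : ThetaDart A K ≃ (A × K) × Bool × Bool where
  toFun d := match d with
    | left i k => ((i, k), false, false)
    | right i k => ((i, k), true, false)
    | midLeft i k => ((i, k), false, true)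
    | midRight i k => ((i, k), true, true)
  invFun t := match t with
    | ((i, k), false, false) => left i k
    | ((i, k), true, false) => right i k
    | ((i, k), false, true) => midLeft i k
    | ((i, k), true, true) => midRight i k
  left_inv d := by cases d <;> rfl
  right_inv t := by rcases t with ⟨⟨i, k⟩, (_ | _), (_ | _)⟩ <;> rfl

instance [Finite A] [Finite K] : Finite (ThetaDart A K) := Finite.of_equiv _ equivProd.symm

/-- Reversal of darts. -/
def rev : Equiv.Perm (ThetaDart A K) where
  toFun d := match d with
    | left i k => midLeft i k
    | right i k => midRight i k
    | midLeft i k => left i k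
    | midRight i k => right i k
  invFun d := match d with
    | left i k => midLeft i k
    | right i k => midRight i k
    | midLeft i k => left i k
    | midRight i k => right i k
  left_inv d := by cases d <;> rfl
  right_inv d := by cases d <;> rfl

theorem numOrbits_rev : numOrbits (rev (A := A) (K := K)) = Nat.card ((A × K) × Bool) := by
  refine numOrbits_eq_card (fun d => match d with
    | left i k => ((i, k), false)
    | right i k => ((i, k), true)
    | midLeft i k => ((i, k), false)
    | midRight i k => ((i, k), true)) (fun t => match t with
    | ((i, k), false) => left i k
    | ((i, k), true) => right i k) ?_ ?_ ?_
  · intro d; cases d <;> rfl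
  · rintro ⟨⟨i, k⟩, (_ | _)⟩ <;> rfl
  · intro d
    cases d with
    | left i k => exact Equiv.Perm.SameCycle.refl _ _
    | right i k => exact Equiv.Perm.SameCycle.refl _ _
    | midLeft i k => exact sameCycle_self_apply rev (left i k)
    | midRight i k => exact sameCycle_self_apply rev (right i k)

variable [AddCommGroup A] {m : ℕ}

/-- The rotation around the vertices. At the midpoints it is given by the shifts `α`
and `β`. -/
def rot (α β : ZMod m → A) : Equiv.Perm (ThetaDart A (ZMod m)) where
  toFun d := match d with
    | left i k => left i (k + 1)
    | right i k => right i (k - 1)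
    | midLeft i k => midRight (i + α k) k
    | midRight i k => midLeft (i + β k) k
  invFun d := match d with
    | left i k => left i (k - 1)
    | right i k => right i (k + 1)
    | midLeft i k => midRight (i - β k) k
    | midRight i k => midLeft (i - α k) k
  left_inv d := by cases d <;> simp
  right_inv d := by cases d <;> simp

variable (α β : ZMod m → A)

theorem rot_right (i : A) (k : ZMod m) : rot α β (right i k) = right i (k - 1) := rfl
theorem rot_midLeft (i : A) (k : ZMod m) : rot α β (midLeft i k) = midRight (i + α k) k := rfl
theorem rot_midRight (i : A) (k : ZMod m) : rot α β (midRight i k) = midLeft (i + β k) k := rfl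

theorem sameCycle_left (i : A) (k l : ZMod m) :
    (rot α β).SameCycle (left i k) (left i l) := by
  have h := Equiv.Perm.SameCycle.add_zsmul (π := rot α β) (f := left i) (τ := 1)
    (fun k => sameCycle_self_apply _ (left i k)) k (l - k).cast
  simpa using h

theorem sameCycle_right (i : A) (k l : ZMod m) :
    (rot α β).SameCycle (right i k) (right i l) := by
  have h := Equiv.Perm.SameCycle.add_zsmul (π := rot α β) (f := right i) (τ := -1)
    (fun k => by
      have := sameCycle_self_apply (rot α β) (right i k)
      rwa [rot_right, sub_eq_add_neg] at this) k (k - l).cast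
  simpa using h

/-- Two rotation steps at a midpoint lead from copy `i` to copy `i + α k + β k`. -/
theorem sameCycle_midLeft {i j : A} {k : ZMod m}
    (h : (QuotientAddGroup.mk i : A ⧸ AddSubgroup.zmultiples (α k + β k))
      = QuotientAddGroup.mk j) :
    (rot α β).SameCycle (midLeft i k) (midLeft j k) := by
  refine Equiv.Perm.SameCycle.of_sub_mem_zmultiples (f := fun i => midLeft i k) (fun i => ?_) h
  rw [← add_assoc]
  exact (sameCycle_self_apply _ (midLeft i k)).trans (sameCycle_self_apply _ (midRight (i + α k) k))

/-- The labels of the vertices. -/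
abbrev VertexLabel := (A ⊕ A) ⊕ (Σ k : ZMod m, A ⧸ AddSubgroup.zmultiples (α k + β k))

/-- The label of the initial vertex of a dart. -/
def vertexLabel : ThetaDart A (ZMod m) → VertexLabel α β
  | left i _ => Sum.inl (Sum.inl i)
  | right i _ => Sum.inl (Sum.inr i)
  | midLeft i k => Sum.inr ⟨k, QuotientAddGroup.mk i⟩
  | midRight i k => Sum.inr ⟨k, QuotientAddGroup.mk (i - α k)⟩

theorem vertexLabel_rot (d : ThetaDart A (ZMod m)) :
    vertexLabel α β (rot α β d) = vertexLabel α β d := by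
  cases d with
  | left i k => rfl
  | right i k => rfl
  | midLeft i k => simp [rot_midLeft, vertexLabel]
  | midRight i k =>
    simp only [rot_midRight, vertexLabel, Sum.inr.injEq, Sigma.mk.injEq, heq_eq_eq, true_and]
    rw [QuotientAddGroup.eq]
    exact ⟨-1, by simp; abel⟩

/-- A dart at a given vertex. -/
noncomputable def dartAt : VertexLabel α β → ThetaDart A (ZMod m)
  | Sum.inl (Sum.inl i) => left i 0
  | Sum.inl (Sum.inr i) => right i 0
  | Sum.inr ⟨k, t⟩ => midLeft t.out k

theorem vertexLabel_dartAt (t : VertexLabel α β) : vertexLabel α β (dartAt α β t) = t := by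
  rcases t with (i | i) | ⟨k, t⟩
  · rfl
  · rfl
  · simp [dartAt, vertexLabel]

theorem sameCycle_dartAt (d : ThetaDart A (ZMod m)) :
    (rot α β).SameCycle (dartAt α β (vertexLabel α β d)) d := by
  cases d with
  | left i k => exact sameCycle_left α β i 0 k
  | right i k => exact sameCycle_right α β i 0 k
  | midLeft i k => exact sameCycle_midLeft α β (by simp)
  | midRight i k =>
    refine Equiv.Perm.SameCycle.trans (y := midLeft (i - α k) k)
      (sameCycle_midLeft α β (by simp)) ?_
    have := sameCycle_self_apply (rot α β) (midLeft (i - α k) k)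
    rwa [rot_midLeft, sub_add_cancel] at this

theorem numOrbits_rot : numOrbits (rot α β) = Nat.card (VertexLabel α β) :=
  numOrbits_eq_card _ _ (vertexLabel_rot α β) (vertexLabel_dartAt α β) (sameCycle_dartAt α β)

/-- The permutation whose orbits are the faces. -/
abbrev faceRot : Equiv.Perm (ThetaDart A (ZMod m)) := rot α β * rev

/-- The labels of the faces. -/
abbrev FaceLabel := Σ k : ZMod m, A ⧸ AddSubgroup.zmultiples (α k + β (k - 1))

/-- The label of the face of a dart. -/
def faceLabel : ThetaDart A (ZMod m) → FaceLabel α β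
  | left i k => ⟨k, QuotientAddGroup.mk i⟩
  | midRight i k => ⟨k, QuotientAddGroup.mk (i - α k)⟩
  | right i k => ⟨k + 1, QuotientAddGroup.mk (i - α (k + 1))⟩
  | midLeft i k => ⟨k + 1, QuotientAddGroup.mk i⟩

theorem faceLabel_rot_rev (d : ThetaDart A (ZMod m)) :
    faceLabel α β (faceRot α β d) = faceLabel α β d := by
  cases d with
  | left i k =>
    change faceLabel α β (midRight (i + α k) k) = _
    simp [faceLabel]
  | right i k =>
    change faceLabel α β (midLeft (i + β k) k) = _
    simp only [faceLabel, Sigma.mk.injEq, heq_eq_eq, true_and]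
    rw [QuotientAddGroup.eq]
    exact ⟨-1, by simp; abel⟩
  | midLeft i k => rfl
  | midRight i k =>
    change faceLabel α β (right i (k - 1)) = _
    simp only [faceLabel]
    rw [sub_add_cancel]

/-- The face between pages `k - 1` and `k` returns to a left dart after four steps, the shifts `α k`
and `β (k - 1)` having been applied at the two midpoints passed. -/
theorem sameCycle_face_left {i j : A} {k : ZMod m}
    (h : (QuotientAddGroup.mk i : A ⧸ AddSubgroup.zmultiples (α k + β (k - 1)))
      = QuotientAddGroup.mk j) :
    (faceRot α β).SameCycle (left i k) (left j k) := by
  refine Equiv.Perm.SameCycle.of_sub_mem_zmultiples (f := fun i => left i k) (fun i => ?_) h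
  have h1 := sameCycle_self_apply (faceRot α β) (left i k)
  have h2 := sameCycle_self_apply (faceRot α β) (midRight (i + α k) k)
  have h3 := sameCycle_self_apply (faceRot α β) (right (i + α k) (k - 1))
  have h4 := sameCycle_self_apply (faceRot α β) (midLeft (i + α k + β (k - 1)) (k - 1))
  have e4 : (faceRot α β) (midLeft (i + α k + β (k - 1)) (k - 1))
      = left (i + (α k + β (k - 1))) k := by
    change left (i + α k + β (k - 1)) (k - 1 + 1) = _
    rw [sub_add_cancel, add_assoc]
  rw [e4] at h4
  exact h1.trans (h2.trans (h3.trans h4))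

theorem sameCycle_face_out (d : ThetaDart A (ZMod m)) :
    (faceRot α β).SameCycle (left (faceLabel α β d).2.out (faceLabel α β d).1) d := by
  cases d with
  | left i k => exact sameCycle_face_left α β (QuotientAddGroup.out_eq' _)
  | midRight i k =>
    refine Equiv.Perm.SameCycle.trans (y := left (i - α k) k)
      (sameCycle_face_left α β (QuotientAddGroup.out_eq' _)) ?_
    have h1 := sameCycle_self_apply (faceRot α β) (left (i - α k) k)
    have e1 : (faceRot α β) (left (i - α k) k) = midRight i k := by
      change midRight (i - α k + α k) k = _
      rw [sub_add_cancel]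
    rwa [e1] at h1
  | right i k =>
    refine Equiv.Perm.SameCycle.trans (y := left (i - α (k + 1)) (k + 1))
      (sameCycle_face_left α β (QuotientAddGroup.out_eq' _)) ?_
    have h1 := sameCycle_self_apply (faceRot α β) (left (i - α (k + 1)) (k + 1))
    have h2 := sameCycle_self_apply (faceRot α β) (midRight i (k + 1))
    have e1 : (faceRot α β) (left (i - α (k + 1)) (k + 1)) = midRight i (k + 1) := by
      change midRight (i - α (k + 1) + α (k + 1)) (k + 1) = _
      rw [sub_add_cancel]
    have e2 : (faceRot α β) (midRight i (k + 1)) = right i k := by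
      change right i (k + 1 - 1) = _
      rw [add_sub_cancel_right]
    rw [e1] at h1
    rw [e2] at h2
    exact h1.trans h2
  | midLeft i k =>
    refine Equiv.Perm.SameCycle.trans (y := left i (k + 1))
      (sameCycle_face_left α β (QuotientAddGroup.out_eq' _)) ?_
    exact (sameCycle_self_apply (faceRot α β) (midLeft i k)).symm

theorem numOrbits_face : numOrbits (faceRot α β) = Nat.card (FaceLabel α β) :=
  numOrbits_eq_card (faceLabel α β) (fun t => left t.2.out t.1) (faceLabel_rot_rev α β)
    (fun t => by simp [faceLabel]) (sameCycle_face_out α β)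

end ThetaDart

/-! ### The choice of shifts and the genus of the surface -/

theorem AddSubgroup.natCard_quotient_zmultiples_zmod {n : ℕ} (hn : n ≠ 0) (a : ℕ) :
    Nat.card (ZMod n ⧸ AddSubgroup.zmultiples (a : ZMod n)) = n.gcd a := by
  have h := AddSubgroup.index_mul_card (AddSubgroup.zmultiples (a : ZMod n))
  rw [Nat.card_zmultiples, ZMod.addOrderOf_coe a hn, Nat.card_zmod] at h
  obtain ⟨c, hc⟩ := Nat.gcd_dvd_left n a
  have hpos : 0 < n.gcd a := Nat.gcd_pos_of_pos_left a (Nat.pos_of_ne_zero hn)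
  have hdiv : n / n.gcd a = c := Nat.div_eq_of_eq_mul_right hpos hc
  have hc0 : 0 < c := Nat.pos_of_ne_zero fun h0 => hn (by rw [hc, h0, mul_zero])
  rw [hdiv] at h
  exact Nat.eq_of_mul_eq_mul_right hc0 (h.trans hc)

namespace ThetaDart

/-- The indices of the pages: two of them carry identifications, the other `N + 1` do not. -/
abbrev Page (N : ℕ) := ZMod (N + 3)

variable (g N : ℕ)

/-- The shift at left darts. -/
def shiftLeft (k : Page N) : ZMod (4 * g + 2) := if k = 0 then -1 else 0

/-- The shift at right darts. -/
def shiftRight (k : Page N) : ZMod (4 * g + 2) :=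
  if k = 0 then ((2 * g + 1 : ℕ) : ZMod (4 * g + 2)) else if k = -1 then 1 else 0

theorem natCast_page_eq {N a b : ℕ} (ha : a < N + 3) (hb : b < N + 3) :
    (a : Page N) = b ↔ a = b := by
  rw [ZMod.natCast_eq_natCast_iff', Nat.mod_eq_of_lt ha, Nat.mod_eq_of_lt hb]

theorem neg_one_page : (-1 : Page N) = ((N + 2 : ℕ) : Page N) := by
  have h : ((N + 3 : ℕ) : Page N) = 0 := ZMod.natCast_self _
  rw [neg_eq_iff_add_eq_zero, ← h]
  push_cast; ring

theorem zero_ne_neg_one_page : (0 : Page N) ≠ -1 := by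
  rw [neg_one_page, ← Nat.cast_zero, Ne, natCast_page_eq (by omega) (by omega)]
  omega

theorem one_ne_zero_page : (1 : Page N) ≠ 0 := by
  rw [← Nat.cast_one, ← Nat.cast_zero, Ne, natCast_page_eq (by omega) (by omega)]
  omega

/-- On page 0 the shift −1 + (2g + 1) = 2g generates a subgroup of index gcd(4g + 2, 2g) = 2,
leaving two vertices; on page −1 the shift 1 leaves one; elsewhere nothing is glued. -/
theorem vertexShift (k : Page N) : shiftLeft g N k + shiftRight g N k
    = ((if k = 0 then 2 * g else if k = -1 then 1 else 0 : ℕ) : ZMod (4 * g + 2)) := by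
  unfold shiftLeft shiftRight
  split_ifs <;> simp

/-- Between pages −1 and 0 the shifts 1 and −1 cancel, so the faces there stay separate. Between
pages 0 and 1 the shift 2g + 1 has order two and merges faces in pairs. This keeps the face count
high enough for genus g. -/
theorem faceShift (k : Page N) : shiftLeft g N k + shiftRight g N (k - 1)
    = ((if k = 1 then 2 * g + 1 else 0 : ℕ) : ZMod (4 * g + 2)) := by
  have h0 : k - 1 = 0 ↔ k = 1 := sub_eq_zero
  have h1 : k - 1 = -1 ↔ k = 0 := by rw [sub_eq_iff_eq_add, neg_add_cancel]
  have h2 := one_ne_zero_page N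
  unfold shiftLeft shiftRight
  simp only [h0, h1]
  by_cases hk : k = 1
  · simp [hk, h2]
  · by_cases hk0 : k = 0 <;> simp [hk, hk0, h2.symm]

theorem card_vertexLabel : Nat.card (VertexLabel (shiftLeft g N) (shiftRight g N))
    = (4 * g + 2) * 2 + (4 * g + 2) * (N + 1) + 3 := by
  have hf : ∀ k : Page N, Nat.card (ZMod (4 * g + 2) ⧸
      AddSubgroup.zmultiples (shiftLeft g N k + shiftRight g N k))
      = if k = 0 then 2 else if k = -1 then 1 else 4 * g + 2 := by
    intro k
    rw [vertexShift, AddSubgroup.natCard_quotient_zmultiples_zmod (by omega)]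
    split_ifs
    · have : 4 * g + 2 = 2 + 2 * g * 2 := by ring
      rw [this, Nat.gcd_add_mul_left_left]
      exact Nat.gcd_eq_left (Nat.dvd_mul_right 2 g)
    · simp
    · simp
  rw [Nat.card_sum, Nat.card_sum, Nat.card_zmod, Nat.card_sigma]
  simp only [hf]
  have h1 := zero_ne_neg_one_page N
  rw [← Finset.add_sum_erase _ _ (Finset.mem_univ (0 : Page N)),
    ← Finset.add_sum_erase _ _ (Finset.mem_erase.2 ⟨h1.symm, Finset.mem_univ (-1 : Page N)⟩),
    if_pos rfl, if_neg h1.symm, if_pos rfl]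
  have h2 : ∀ k ∈ ((Finset.univ : Finset (Page N)).erase 0).erase (-1),
      (if k = 0 then 2 else if k = -1 then 1 else 4 * g + 2) = 4 * g + 2 := by
    intro k hk
    simp only [Finset.mem_erase] at hk
    rw [if_neg hk.2.1, if_neg hk.1]
  rw [Finset.sum_congr rfl h2, Finset.sum_const, Finset.card_erase_of_mem
    (Finset.mem_erase.2 ⟨h1.symm, Finset.mem_univ (-1 : Page N)⟩), Finset.card_erase_of_mem
    (Finset.mem_univ (0 : Page N)), Finset.card_univ, ZMod.card]
  simp only [smul_eq_mul]
  have : N + 3 - 1 - 1 = N + 1 := by omega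
  rw [this]; ring

theorem card_faceLabel : Nat.card (FaceLabel (shiftLeft g N) (shiftRight g N))
    = (4 * g + 2) * (N + 2) + (2 * g + 1) := by
  have hf : ∀ k : Page N, Nat.card (ZMod (4 * g + 2) ⧸
      AddSubgroup.zmultiples (shiftLeft g N k + shiftRight g N (k - 1)))
      = if k = 1 then 2 * g + 1 else 4 * g + 2 := by
    intro k
    rw [faceShift, AddSubgroup.natCard_quotient_zmultiples_zmod (by omega)]
    split_ifs
    · have : 4 * g + 2 = (2 * g + 1) * 2 := by ring
      rw [this, Nat.gcd_mul_right_left]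
    · simp
  rw [Nat.card_sigma]
  simp only [hf]
  rw [← Finset.add_sum_erase _ _ (Finset.mem_univ (1 : Page N)), if_pos rfl]
  have h2 : ∀ k ∈ (Finset.univ : Finset (Page N)).erase 1,
      (if k = 1 then 2 * g + 1 else 4 * g + 2) = 4 * g + 2 :=
    fun k hk => if_neg (Finset.mem_erase.1 hk).1
  rw [Finset.sum_congr rfl h2, Finset.sum_const, Finset.card_erase_of_mem
    (Finset.mem_univ (1 : Page N)), Finset.card_univ, ZMod.card, smul_eq_mul]
  have : N + 3 - 1 = N + 2 := by omega
  rw [this]; ring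

/-- All copies meet in the single midpoint vertex of page −1. -/
theorem connected_surface (d e : ThetaDart (ZMod (4 * g + 2)) (Page N)) :
    ∃ π ∈ Subgroup.closure {rot (shiftLeft g N) (shiftRight g N), rev}, π d = e := by
  set ρ := rot (shiftLeft g N) (shiftRight g N) with hρ
  set G := Subgroup.closure {ρ, rev} with hG
  let r : ThetaDart (ZMod (4 * g + 2)) (Page N) → ThetaDart (ZMod (4 * g + 2)) (Page N) → Prop :=
    fun d e => ∃ π ∈ G, π d = e
  have hsymm : ∀ {d e}, r d e → r e d := by
    rintro d _ ⟨π, hπ, rfl⟩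
    exact ⟨π⁻¹, inv_mem hπ, by simp⟩
  have htrans : ∀ {d e f}, r d e → r e f → r d f := by
    rintro d _ _ ⟨π, hπ, rfl⟩ ⟨σ, hσ, rfl⟩
    exact ⟨σ * π, mul_mem hσ hπ, rfl⟩
  have hrev : ∀ d, r d (rev d) := fun d =>
    ⟨rev, Subgroup.subset_closure (by simp), rfl⟩
  have hcyc : ∀ {d e}, ρ.SameCycle d e → r d e := by
    rintro d e ⟨z, hz⟩
    exact ⟨ρ ^ z, zpow_mem (Subgroup.subset_closure (by simp)) z, hz⟩
  have hmid : ∀ i : ZMod (4 * g + 2), r (midLeft 0 (-1)) (midLeft i (-1)) := by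
    intro i
    refine hcyc (sameCycle_midLeft _ _ ?_)
    rw [QuotientAddGroup.eq, vertexShift, if_neg (zero_ne_neg_one_page N).symm, if_pos rfl]
    exact ⟨i.cast, by simp⟩
  have hleft : ∀ i k, r (midLeft 0 (-1)) (left i k) := fun i k =>
    htrans (hmid i) (htrans (hrev _) (hcyc (sameCycle_left _ _ i (-1) k)))
  have hmidRight : ∀ i k, r (midLeft 0 (-1)) (midRight i k) := by
    intro i k
    have h := hcyc (sameCycle_self_apply ρ (midLeft (i - shiftLeft g N k) k))
    rw [hρ, rot_midLeft, sub_add_cancel] at h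
    exact htrans (hleft _ k) (htrans (hrev _) h)
  have hall : ∀ d, r (midLeft 0 (-1)) d := by
    intro d
    cases d with
    | left i k => exact hleft i k
    | midLeft i k => exact htrans (hleft i k) (hrev _)
    | right i k => exact htrans (hmidRight i k) (hrev _)
    | midRight i k => exact hmidRight i k
  exact htrans (hsymm (hall d)) (hall e)

/-- A surface of genus `g` made of `4 * g + 2` theta graphs. -/
def surface : CellSurface where
  Dart := ThetaDart (ZMod (4 * g + 2)) (Page N)
  finite_dart := inferInstance
  nonempty_dart := ⟨left 0 0⟩
  rot := rot (shiftLeft g N) (shiftRight g N)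
  rev := rev
  rev_rev d := by cases d <;> rfl
  rev_ne d := by cases d <;> simp [rev]
  connected := connected_surface g N

theorem surface_hasGenus : (surface g N).HasGenus g := by
  have hV : numOrbits (surface g N).rot = _ := (numOrbits_rot _ _).trans (card_vertexLabel g N)
  have hE : numOrbits (surface g N).rev = _ := numOrbits_rev
  have hF : numOrbits ((surface g N).rot * (surface g N).rev) = _ :=
    (numOrbits_face _ _).trans (card_faceLabel g N)
  rw [CellSurface.HasGenus, CellSurface.eulerChar, hV, hE, hF]
  rw [Nat.card_prod, Nat.card_prod, Nat.card_zmod, Nat.card_zmod, Nat.card_eq_fintype_card,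
    Fintype.card_bool]
  push_cast; ring

/-- Graphs embed into the surface when their vertices can be given vertex labels. -/
theorem embedsInGenus {V : Type*} (Γ : SimpleGraph V)
    (F : V → VertexLabel (shiftLeft g N) (shiftRight g N)) (hF : Function.Injective F)
    (hadj : ∀ u v, Γ.Adj u v → ∃ d, vertexLabel (shiftLeft g N) (shiftRight g N) d = F u ∧
      vertexLabel (shiftLeft g N) (shiftRight g N) (rev d) = F v) : Γ.EmbedsInGenus g := by
  set L := vertexLabel (shiftLeft g N) (shiftRight g N) with hL
  have horig : ∀ d t, L d = t → (surface g N).origin d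
      = (surface g N).origin (dartAt (shiftLeft g N) (shiftRight g N) t) := by
    rintro d _ rfl
    exact (Quotient.sound (sameCycle_dartAt (shiftLeft g N) (shiftRight g N) d)).symm
  have hlift : ∀ d e : (surface g N).Dart, (surface g N).rot.SameCycle d e → L d = L e :=
    fun d e h => Equiv.Perm.SameCycle.apply_eq (q := L) (vertexLabel_rot _ _) h
  refine ⟨surface g N, surface_hasGenus g N, fun v => (surface g N).origin
    (dartAt (shiftLeft g N) (shiftRight g N) (F v)), fun u v h => hF ?_, fun u v h => ?_⟩
  · have := hlift _ _ (Quotient.exact h)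
    rwa [hL, vertexLabel_dartAt, vertexLabel_dartAt] at this
  · obtain ⟨d, h1, h2⟩ := hadj u v h
    exact ⟨d, horig d _ h1, horig _ _ h2⟩

end ThetaDart

/-! ### Placing hubs and bundles on the surface -/

namespace SpokeVertex

/-- The ascending edges of the graph formed by three hubs and by the paths from atoms to
coatoms. -/
inductive Link {ι : Type*} : SpokeVertex ι → SpokeVertex ι → Prop
  | bot_atom (i : ι) : Link bot (atom i)
  | atom_mid (i : ι) : Link (atom i) mid
  | mid_coatom (i : ι) : Link mid (coatom i)
  | coatom_top (i : ι) : Link (coatom i) top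
  | atom_cyc (i : ι) : Link (atom i) (cyc i)
  | cyc_coatom (i : ι) : Link (cyc i) (coatom i)

end SpokeVertex

namespace ThetaDart

open SpokeVertex

variable {ι : Type*} {g N : ℕ} (e : ι → ZMod (4 * g + 2))

/-- The label of the vertex on page `k` in class `i`. -/
def pageLabel (k : Page N) (i : ZMod (4 * g + 2)) :
    VertexLabel (shiftLeft g N) (shiftRight g N) :=
  Sum.inr ⟨k, QuotientAddGroup.mk i⟩

theorem pageLabel_eq {k : Page N} {i j : ZMod (4 * g + 2)}
    (h : ∃ z : ℤ, z • (shiftLeft g N k + shiftRight g N k) = -i + j) :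
    pageLabel k i = pageLabel k j := by
  have : (QuotientAddGroup.mk i : ZMod (4 * g + 2) ⧸
      AddSubgroup.zmultiples (shiftLeft g N k + shiftRight g N k)) = QuotientAddGroup.mk j := by
    rw [QuotientAddGroup.eq]
    exact h
  rw [pageLabel, this, pageLabel]

theorem pageLabel_zero_add {i t : ZMod (4 * g + 2)} :
    pageLabel (0 : Page N) (i + 2 * t) = pageLabel 0 i := by
  -- Modulo 4g + 2 one has 4g = −2, so 2t times the generator 2g is −2t.
  refine pageLabel_eq ⟨2 * t.cast, ?_⟩
  have h : ((4 * g + 2 : ℕ) : ZMod (4 * g + 2)) = 0 := ZMod.natCast_self _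
  rw [vertexShift, if_pos rfl, zsmul_eq_mul]
  push_cast at h ⊢
  linear_combination t * h

theorem pageLabel_neg_one (i j : ZMod (4 * g + 2)) :
    pageLabel (-1 : Page N) i = pageLabel (-1) j := by
  refine pageLabel_eq ⟨(-i + j).cast, ?_⟩
  rw [vertexShift, if_neg (zero_ne_neg_one_page N).symm, if_pos rfl, zsmul_eq_mul]
  simp

/-- Reduction modulo 2 is well defined on `ZMod (4 * g + 2)` and kills the shift 2g, so parity
separates the two classes. -/
theorem pageLabel_zero_ne : pageLabel (g := g) (0 : Page N) 0 ≠ pageLabel 0 1 := by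
  intro h
  simp only [pageLabel, Sum.inr.injEq, Sigma.mk.injEq, heq_eq_eq, true_and] at h
  rw [QuotientAddGroup.eq] at h
  obtain ⟨z, hz⟩ := h
  have hd : 2 ∣ 4 * g + 2 := ⟨2 * g + 1, by ring⟩
  change z • (shiftLeft g N 0 + shiftRight g N 0) = -0 + 1 at hz
  rw [vertexShift, if_pos rfl] at hz
  have := congrArg (ZMod.castHom hd (ZMod 2)) hz
  have h2 : ((2 * g : ℕ) : ZMod 2) = 0 := (ZMod.natCast_eq_zero_iff _ _).2 ⟨g, rfl⟩
  rw [map_zsmul, map_natCast, h2, smul_zero, map_add, map_neg, map_zero, map_one] at this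
  simp at this

open Classical in
/-- The label of a vertex of type `t`, put on page `k` if it is the middle of a path from an atom to
a coatom. -/
noncomputable def spokeLabel (t : SpokeVertex ι) (k : Page N) :
    VertexLabel (shiftLeft g N) (shiftRight g N) :=
  match t with
  | bot => pageLabel 0 0
  | top => pageLabel 0 1
  | mid => pageLabel (-1) 0
  | atom i => if Even (e i) then Sum.inl (Sum.inl (e i)) else Sum.inl (Sum.inr (e i))
  | coatom i => if Even (e i) then Sum.inl (Sum.inr (e i)) else Sum.inl (Sum.inl (e i))
  | cyc i => pageLabel k (e i)

theorem spokeLabel_injective (he : Function.Injective e) {s t : SpokeVertex ι} {k l : Page N}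
    (hk : k ≠ 0 ∧ k ≠ -1) (hl : l ≠ 0 ∧ l ≠ -1) (h : spokeLabel e s k = spokeLabel e t l) :
    k = l ∨ (s = t ∧ ∀ i, s ≠ cyc i) := by
  have hpage : ∀ {k l : Page N} {i j : ZMod (4 * g + 2)}, pageLabel k i = pageLabel l j → k = l :=
    fun h => congrArg Sigma.fst (Sum.inr_injective h)
  have h01 := zero_ne_neg_one_page N
  have hne := pageLabel_zero_ne (g := g) (N := N)
  cases s <;> cases t <;> simp only [spokeLabel] at h <;>
    first
    | exact Or.inl (hpage h)
    | exact Or.inr ⟨rfl, fun i => by simp⟩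
    | exact absurd h hne
    | exact absurd h.symm hne
    | exact absurd (hpage h) h01
    | exact absurd (hpage h) h01.symm
    | exact absurd (hpage h) hk.1
    | exact absurd (hpage h) hk.2
    | exact absurd (hpage h).symm hl.1
    | exact absurd (hpage h).symm hl.2
    | (split_ifs at h <;> simp [pageLabel, he.eq_iff] at h <;> subst h <;>
        first
        | contradiction
        | exact Or.inr ⟨rfl, fun i => by simp⟩)

theorem exists_two_mul_add_one {n : ℕ} {i : ZMod (n + 1)} (h : ¬ Even i) : ∃ t, i = 1 + 2 * t := by
  obtain ⟨t, ht | ht⟩ := Nat.even_or_odd' i.val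
  · refine absurd ⟨(t : ZMod (n + 1)), ?_⟩ h
    rw [← ZMod.natCast_zmod_val i, ht]; push_cast; ring
  · refine ⟨t, ?_⟩
    rw [← ZMod.natCast_zmod_val i, ht]; push_cast; ring

/-- On page 0 the left end of copy i meets the class of i and the right end the class of i + 1. The
even class is `bot` and the odd one `top`, so the roles of atom and coatom are exchanged between the
two ends according to the parity of i. -/
theorem exists_dart_of_link {s t : SpokeVertex ι} (h : Link s t) {k l : Page N}
    (hk : k ≠ 0 ∧ k ≠ -1) (hl : l ≠ 0 ∧ l ≠ -1) :
    ∃ d, vertexLabel (shiftLeft g N) (shiftRight g N) d = spokeLabel e s k ∧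
      vertexLabel (shiftLeft g N) (shiftRight g N) (rev d) = spokeLabel e t l := by
  have hmL : ∀ i (k : Page N), vertexLabel (shiftLeft g N) (shiftRight g N) (midLeft i k)
    = pageLabel k i := fun _ _ => rfl
  have hmR : ∀ i (k : Page N), vertexLabel (shiftLeft g N) (shiftRight g N) (midRight i k)
    = pageLabel k (i - shiftLeft g N k) := fun _ _ => rfl
  have hs : ∀ k : Page N, k ≠ 0 → shiftLeft g N k = 0 := fun k hk => if_neg hk
  have h0 : shiftLeft g N 0 = -1 := if_pos rfl
  have heven : ∀ {i : ZMod (4 * g + 2)}, Even i → pageLabel (0 : Page N) i = pageLabel 0 0 ∧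
      pageLabel (0 : Page N) (i + 1) = pageLabel 0 1 := by
    rintro _ ⟨t, rfl⟩
    rw [← two_mul, add_comm _ (1 : ZMod (4 * g + 2)), pageLabel_zero_add,
      ← pageLabel_zero_add (i := 0) (t := t), zero_add]
    exact ⟨rfl, rfl⟩
  have hodd : ∀ {i : ZMod (4 * g + 2)}, ¬ Even i → pageLabel (0 : Page N) i = pageLabel 0 1 ∧
      pageLabel (0 : Page N) (i + 1) = pageLabel 0 0 := by
    intro i hi
    obtain ⟨t, rfl⟩ := exists_two_mul_add_one hi
    refine ⟨pageLabel_zero_add, ?_⟩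
    rw [← pageLabel_zero_add (i := 0) (t := 1 + t)]
    congr 1; ring
  cases h with
  | bot_atom i =>
    by_cases hi : Even (e i)
    · exact ⟨midLeft (e i) 0, (heven hi).1, (if_pos hi).symm⟩
    · refine ⟨midRight (e i) 0, ?_, (if_neg hi).symm⟩
      rw [hmR, h0, sub_neg_eq_add]
      exact (hodd hi).2
  | atom_mid i =>
    by_cases hi : Even (e i)
    · exact ⟨left (e i) (-1), (if_pos hi).symm, pageLabel_neg_one _ _⟩
    · exact ⟨right (e i) (-1), (if_neg hi).symm, pageLabel_neg_one _ _⟩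
  | mid_coatom i =>
    by_cases hi : Even (e i)
    · exact ⟨midRight (e i) (-1), pageLabel_neg_one _ _, (if_pos hi).symm⟩
    · exact ⟨midLeft (e i) (-1), pageLabel_neg_one _ _, (if_neg hi).symm⟩
  | coatom_top i =>
    by_cases hi : Even (e i)
    · refine ⟨right (e i) 0, (if_pos hi).symm, (hmR _ _).trans ?_⟩
      rw [h0, sub_neg_eq_add]
      exact (heven hi).2
    · exact ⟨left (e i) 0, (if_neg hi).symm, (hodd hi).1⟩
  | atom_cyc i =>
    by_cases hi : Even (e i)
    · exact ⟨left (e i) l, (if_pos hi).symm, rfl⟩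
    · refine ⟨right (e i) l, (if_neg hi).symm, (hmR _ _).trans ?_⟩
      rw [hs l hl.1, sub_zero]; rfl
  | cyc_coatom i =>
    by_cases hi : Even (e i)
    · refine ⟨midRight (e i) k, (hmR _ _).trans ?_, (if_pos hi).symm⟩
      rw [hs k hk.1, sub_zero]; rfl
    · exact ⟨midLeft (e i) k, rfl, (if_neg hi).symm⟩

end ThetaDart

open ThetaDart SpokeVertex in
/-- A graph formed by three hubs and at most `4 * g + 2` bundles of paths from atoms to coatoms
embeds into the surface of genus `g`. -/
theorem SimpleGraph.embedsInGenus_of_spokes {V ι : Type*} [Finite V] (Γ : SimpleGraph V)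
    (c : V → SpokeVertex ι) (hc : ∀ u v, c u = c v → u = v ∨ ∃ i, c u = cyc i)
    (hadj : ∀ u v, Γ.Adj u v → Link (c u) (c v) ∨ Link (c v) (c u))
    {g : ℕ} (e : ι → ZMod (4 * g + 2)) (he : Function.Injective e) : Γ.EmbedsInGenus g := by
  -- Every vertex receives its own page, though only those of type `cyc` use it. The indices 1, …,
  -- |V| avoid the glued pages 0 and −1 = |V| + 2.
  let page : V → Page (Nat.card V) := fun v => (((Finite.equivFin V v).val + 1 : ℕ) : Page _)
  have hlt : ∀ v, (Finite.equivFin V v).val + 1 < Nat.card V + 2 := fun v => by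
    have := (Finite.equivFin V v).isLt
    omega
  have hpage : Function.Injective page := by
    intro u v h
    have h' := (natCast_page_eq ((hlt u).trans (by omega)) ((hlt v).trans (by omega))).1 h
    exact (Finite.equivFin V).injective (Fin.ext (by omega))
  have hgood : ∀ v, page v ≠ 0 ∧ page v ≠ -1 := by
    intro v
    have h := hlt v
    constructor
    · rw [← Nat.cast_zero, Ne, natCast_page_eq (by omega) (by omega)]
      omega
    · rw [neg_one_page, Ne, natCast_page_eq (by omega) (by omega)]
      omega
  refine embedsInGenus g (Nat.card V) Γ (fun v => spokeLabel e (c v) (page v)) ?_ ?_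
  · intro u v h
    rcases spokeLabel_injective e he (hgood u) (hgood v) h with h | ⟨h, h'⟩
    · exact hpage h
    · rcases hc u v h with h | ⟨i, hi⟩
      · exact h
      · exact absurd hi (h' i)
  · intro u v h
    rcases hadj u v h with h | h
    · exact exists_dart_of_link e h (hgood u) (hgood v)
    · obtain ⟨d, h1, h2⟩ := exists_dart_of_link e h (hgood v) (hgood u)
      refine ⟨rev d, h2, ?_⟩
      have : rev (rev d) = d := by cases d <;> rfl
      rw [this, h1]

/-! ### Subgroups of a group of order p⁴ with G[p] = pG -/

section HomocyclicGroup

variable {G : Type*} [AddCommGroup G] {p : ℕ}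

/-- The subgroup of elements annihilated by `p`. -/
def torsionSubgroup (G : Type*) [AddCommGroup G] (p : ℕ) : AddSubgroup G :=
  (nsmulAddMonoidHom p : G →+ G).ker

/-- The subgroup of multiples by `p` of the elements of `H`. -/
def pMap (p : ℕ) (H : AddSubgroup G) : AddSubgroup G := H.map (nsmulAddMonoidHom p : G →+ G)

/-- The subgroup of elements whose multiple by `p` is in `H`. -/
def pComap (p : ℕ) (H : AddSubgroup G) : AddSubgroup G := H.comap (nsmulAddMonoidHom p : G →+ G)

theorem mem_torsionSubgroup {x : G} : x ∈ torsionSubgroup G p ↔ p • x = 0 := Iff.rfl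

theorem mem_pMap {H : AddSubgroup G} {x : G} : x ∈ pMap p H ↔ ∃ y ∈ H, p • y = x := Iff.rfl

theorem mem_pComap {H : AddSubgroup G} {x : G} : x ∈ pComap p H ↔ p • x ∈ H := Iff.rfl

/-- The subgroups of order `p`. -/
abbrev AtomSubgroup (G : Type*) [AddCommGroup G] (p : ℕ) :=
  {A : AddSubgroup G // Nat.card A = p}

theorem AtomSubgroup.le_torsion (A : AtomSubgroup G p) : A.1 ≤ torsionSubgroup G p := by
  intro x hx
  have h := card_nsmul_eq_zero' (x := (⟨x, hx⟩ : A.1))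
  rw [A.2] at h
  exact congrArg Subtype.val h

/-- First isomorphism theorem for multiplication by p on `H`. -/
theorem natCard_eq_mul (H : AddSubgroup G) :
    Nat.card H = Nat.card (pMap p H) * Nat.card (H ⊓ torsionSubgroup G p : AddSubgroup G) := by
  let f : H →+ G := (nsmulAddMonoidHom p : G →+ G).comp H.subtype
  have h1 : pMap p H = f.range := by
    ext x
    simp [mem_pMap, f]
  have h2 : f.ker = (torsionSubgroup G p).addSubgroupOf H := rfl
  rw [h1, ← AddSubgroup.card_mul_index f.ker, AddSubgroup.index_ker, mul_comm, h2,
    inf_comm, ← Nat.card_congr (AddSubgroup.addSubgroupOfEquivOfLe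
      (inf_le_right : torsionSubgroup G p ⊓ H ≤ H)).toEquiv, AddSubgroup.inf_addSubgroupOf_right]

theorem natCard_zmultiples_of_mem_torsion (hp : p.Prime) {x : G}
    (hx : x ∈ torsionSubgroup G p) (hx0 : x ≠ 0) : Nat.card (AddSubgroup.zmultiples x) = p := by
  have : Fact p.Prime := ⟨hp⟩
  rw [Nat.card_zmultiples]
  exact addOrderOf_eq_prime hx hx0

theorem torsion_le_pComap (H : AddSubgroup G) : torsionSubgroup G p ≤ pComap p H := by
  intro x hx
  rw [mem_pComap, mem_torsionSubgroup.1 hx]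
  exact zero_mem H

theorem pComap_pMap {H : AddSubgroup G} (h : torsionSubgroup G p ≤ H) :
    pComap p (pMap p H) = H := by
  ext x
  rw [mem_pComap, mem_pMap]
  refine ⟨?_, fun hx => ⟨x, hx, rfl⟩⟩
  rintro ⟨y, hy, hxy⟩
  have : x - y ∈ torsionSubgroup G p := by
    rw [mem_torsionSubgroup, smul_sub, hxy, sub_self]
  simpa using add_mem (h this) hy

variable (hp : p.Prime) (hG : Nat.card G = p ^ 4) (hT : torsionSubgroup G p = pMap p ⊤)

include hG hT in
theorem natCard_torsionSubgroup : Nat.card (torsionSubgroup G p) = p ^ 2 := by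
  have h := natCard_eq_mul (p := p) (⊤ : AddSubgroup G)
  rw [← hT, top_inf_eq, AddSubgroup.card_top, hG] at h
  have : (p ^ 2) ^ 2 = (Nat.card (torsionSubgroup G p)) ^ 2 := by rw [← pow_mul, h, sq]
  exact (Nat.pow_left_injective two_ne_zero this).symm

include hT in
theorem pMap_le_torsion (H : AddSubgroup G) : pMap p H ≤ torsionSubgroup G p := by
  rw [hT]
  exact AddSubgroup.map_mono le_top

include hT in
theorem pMap_pComap {H : AddSubgroup G} (h : H ≤ torsionSubgroup G p) :
    pMap p (pComap p H) = H := by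
  ext x
  rw [mem_pMap]
  constructor
  · rintro ⟨y, hy, rfl⟩
    exact hy
  · intro hx
    have hx' := h hx
    rw [hT] at hx'
    obtain ⟨y, -, rfl⟩ := mem_pMap.1 hx'
    exact ⟨y, hx, rfl⟩

include hp hG hT in
theorem AtomSubgroup.lt_torsion (A : AtomSubgroup G p) : A.1 < torsionSubgroup G p := by
  refine lt_of_le_of_ne A.le_torsion fun h => ?_
  have h1 := natCard_torsionSubgroup hG hT
  rw [← h, A.2] at h1
  have := hp.one_lt
  nlinarith

variable [Finite G]

theorem AddSubgroup.eq_of_le_of_natCard_eq {H K : AddSubgroup G} (h : H ≤ K)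
    (hc : Nat.card H = Nat.card K) : H = K :=
  AddSubgroup.eq_of_le_of_card_ge h hc.ge

theorem AddSubgroup.covBy_of_natCard_eq_mul (hp : p.Prime) {H K : AddSubgroup G} (h : H ≤ K)
    (hc : Nat.card K = p * Nat.card H) : H ⋖ K := by
  have hpos : 0 < Nat.card H := Nat.card_pos
  refine ⟨lt_of_le_of_ne h fun heq => ?_, fun L hHL hLK => ?_⟩
  · rw [heq] at hc hpos
    have := hp.one_lt
    nlinarith
  · obtain ⟨a, ha⟩ := AddSubgroup.card_dvd_of_le hHL.le
    obtain ⟨b, hb⟩ := AddSubgroup.card_dvd_of_le hLK.le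
    have hab : a * b = p := by
      rw [hc, ha, mul_comm p, mul_assoc] at hb
      exact (Nat.eq_of_mul_eq_mul_left hpos hb).symm
    rcases (Nat.dvd_prime hp).1 ⟨b, hab.symm⟩ with rfl | rfl
    · exact hHL.ne (AddSubgroup.eq_of_le_of_natCard_eq hHL.le (by rw [ha, mul_one]))
    · have : b = 1 := Nat.eq_of_mul_eq_mul_left hp.pos (by rw [hab, mul_one])
      exact hLK.ne (AddSubgroup.eq_of_le_of_natCard_eq hLK.le (by rw [hb, this, mul_one]))

theorem AtomSubgroup.zmultiples_eq (hp : p.Prime) (A : AtomSubgroup G p) {x : G} (hx : x ∈ A.1)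
    (hx0 : x ≠ 0) : AddSubgroup.zmultiples x = A.1 := by
  have hle : AddSubgroup.zmultiples x ≤ A.1 := by rwa [AddSubgroup.zmultiples_le]
  refine AddSubgroup.eq_of_le_of_natCard_eq hle ?_
  have hd := AddSubgroup.card_dvd_of_le hle
  rw [A.2] at hd ⊢
  refine ((Nat.dvd_prime hp).1 hd).resolve_left fun h1 => hx0 ?_
  rwa [Nat.card_zmultiples, AddMonoid.addOrderOf_eq_one_iff] at h1

theorem AtomSubgroup.eq_of_le (A B : AtomSubgroup G p) (h : A.1 ≤ B.1) : A = B :=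
  Subtype.ext (AddSubgroup.eq_of_le_of_natCard_eq h (A.2.trans B.2.symm))

theorem AtomSubgroup.exists_ne_zero (hp : p.Prime) (A : AtomSubgroup G p) : ∃ x ∈ A.1, x ≠ 0 := by
  have : Nontrivial A.1 := Finite.one_lt_card_iff_nontrivial.1 (A.2.symm ▸ hp.one_lt)
  obtain ⟨x, hx⟩ := exists_ne (0 : A.1)
  exact ⟨x, x.2, fun h => hx (Subtype.ext h)⟩

include hp in
/-- The nonzero elements of order `p` are partitioned among the subgroups of order `p`. -/
theorem natCard_atomSubgroup_mul :
    Nat.card (AtomSubgroup G p) * (p - 1) = Nat.card (torsionSubgroup G p) - 1 := by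
  have hne : ∀ H : AddSubgroup G, Nat.card {x : H // x ≠ 0} = Nat.card H - 1 := by
    intro H
    have : Fintype H := Fintype.ofFinite _
    classical
    rw [Nat.card_eq_fintype_card, Nat.card_eq_fintype_card, Fintype.card_subtype_compl,
      Fintype.card_subtype_eq]
  have : Fintype (AtomSubgroup G p) := Fintype.ofFinite _
  rw [← hne]
  let f : (Σ A : AtomSubgroup G p, {x : A.1 // x ≠ 0}) → {x : torsionSubgroup G p // x ≠ 0} :=
    fun t => ⟨⟨t.2.1.1, t.1.le_torsion t.2.1.2⟩, fun h =>
      t.2.2 (Subtype.ext (congrArg (fun x => (x.1 : G)) h))⟩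
  have hf : Function.Bijective f := by
    constructor
    · rintro ⟨A, ⟨⟨x, hx⟩, hx0⟩⟩ ⟨B, ⟨⟨y, hy⟩, hy0⟩⟩ h
      have hxy : x = y := congrArg (fun x => (x.1.1 : G)) h
      subst hxy
      have hx0' : x ≠ 0 := fun h => hx0 (Subtype.ext h)
      obtain rfl : A = B := Subtype.ext
        ((A.zmultiples_eq hp hx hx0').symm.trans (B.zmultiples_eq hp hy hx0'))
      rfl
    · rintro ⟨⟨x, hx⟩, hx0⟩
      have hx0' : x ≠ 0 := fun h => hx0 (Subtype.ext h)
      exact ⟨⟨⟨AddSubgroup.zmultiples x, natCard_zmultiples_of_mem_torsion hp hx hx0'⟩,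
        ⟨⟨x, AddSubgroup.mem_zmultiples x⟩, fun h => hx0' (congrArg Subtype.val h)⟩⟩, rfl⟩
  rw [← Nat.card_congr (Equiv.ofBijective f hf), Nat.card_sigma]
  simp only [hne]
  rw [Finset.sum_congr rfl fun A _ => by rw [A.2], Finset.sum_const, Finset.card_univ,
    Nat.card_eq_fintype_card, smul_eq_mul]

include hp hG hT in
theorem natCard_atomSubgroup : Nat.card (AtomSubgroup G p) = p + 1 := by
  have h := natCard_atomSubgroup_mul (G := G) hp
  rw [natCard_torsionSubgroup hG hT] at h
  have h1 := hp.one_lt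
  have h2 : p ^ 2 - 1 = (p + 1) * (p - 1) := by
    have := Nat.sq_sub_sq p 1
    rwa [one_pow] at this
  exact Nat.eq_of_mul_eq_mul_right (by omega) (h.trans h2)

include hp hG hT in
theorem eq_of_le_torsion {H : AddSubgroup G} (h : H ≤ torsionSubgroup G p) :
    H = ⊥ ∨ H = torsionSubgroup G p ∨ Nat.card H = p := by
  have hd := AddSubgroup.card_dvd_of_le h
  rw [natCard_torsionSubgroup hG hT, Nat.dvd_prime_pow hp] at hd
  obtain ⟨k, hk, hc⟩ := hd
  interval_cases k
  · left
    rw [pow_zero] at hc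
    exact AddSubgroup.card_eq_one.1 hc
  · right; right
    rw [hc, pow_one]
  · right; left
    exact AddSubgroup.eq_of_le_of_natCard_eq h (hc.trans (natCard_torsionSubgroup hG hT).symm)

open SpokeVertex

/-- The position of a subgroup in the subgroup lattice. -/
def HasKind (H : AddSubgroup G) : SpokeVertex (AtomSubgroup G p) → Prop
  | bot => H = ⊥
  | mid => H = torsionSubgroup G p
  | top => H = ⊤
  | atom A => H = A.1
  | coatom A => H = pComap p A.1
  | cyc A => ¬ H ≤ torsionSubgroup G p ∧ ¬ torsionSubgroup G p ≤ H ∧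
      H ⊓ torsionSubgroup G p = A.1 ∧ pMap p H = A.1

include hp hG hT in
theorem exists_hasKind (H : AddSubgroup G) : ∃ t : SpokeVertex (AtomSubgroup G p), HasKind H t := by
  by_cases h1 : H ≤ torsionSubgroup G p
  · rcases eq_of_le_torsion hp hG hT h1 with h | h | h
    · exact ⟨bot, h⟩
    · exact ⟨mid, h⟩
    · exact ⟨atom ⟨H, h⟩, rfl⟩
  by_cases h2 : torsionSubgroup G p ≤ H
  · rw [← pComap_pMap h2]
    rcases eq_of_le_torsion hp hG hT (pMap_le_torsion hT H) with h | h | h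
    · rw [h]; exact ⟨mid, rfl⟩
    · refine ⟨top, ?_⟩
      rw [h, hT]; exact pComap_pMap le_top
    · exact ⟨coatom ⟨_, h⟩, rfl⟩
  have h3 : pMap p H ≠ ⊥ := by
    intro h
    refine h1 fun x hx => ?_
    have : p • x ∈ pMap p H := ⟨x, hx, rfl⟩
    rw [h] at this
    exact AddSubgroup.mem_bot.1 this
  have h4 : H ⊓ torsionSubgroup G p ≠ torsionSubgroup G p := fun h => h2 (inf_eq_right.1 h)
  -- As pH is nonzero and H ∩ T is not all of T, this inclusion forces both to have order p, hence
  -- to coincide.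
  have h5 : pMap p H ≤ H ⊓ torsionSubgroup G p := by
    refine le_inf ?_ (pMap_le_torsion hT H)
    rintro _ ⟨x, hx, rfl⟩
    exact nsmul_mem hx p
  have h6 : Nat.card (H ⊓ torsionSubgroup G p : AddSubgroup G) = p := by
    rcases eq_of_le_torsion hp hG hT (inf_le_right : H ⊓ torsionSubgroup G p ≤ _) with h | h | h
    · rw [h, le_bot_iff] at h5
      exact absurd h5 h3
    · exact absurd h h4
    · exact h
  have h7 : Nat.card (pMap p H) = p := by
    rcases eq_of_le_torsion hp hG hT (pMap_le_torsion hT H) with h | h | h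
    · exact absurd h h3
    · rw [h] at h5
      exact absurd (le_antisymm inf_le_right h5) h4
    · exact h
  exact ⟨cyc ⟨_, h6⟩, h1, h2, rfl, AddSubgroup.eq_of_le_of_natCard_eq h5 (h7.trans h6.symm)⟩

include hp in
theorem AtomSubgroup.bot_lt (A : AtomSubgroup G p) : ⊥ < A.1 := by
  obtain ⟨x, hx, hx0⟩ := A.exists_ne_zero hp
  rw [bot_lt_iff_ne_bot]
  intro h
  rw [h] at hx
  exact hx0 hx

include hp hT in
theorem AtomSubgroup.torsion_lt_pComap (A : AtomSubgroup G p) :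
    torsionSubgroup G p < pComap p A.1 := by
  refine lt_of_le_of_ne (torsion_le_pComap _) fun h => ?_
  obtain ⟨x, hx, hx0⟩ := A.exists_ne_zero hp
  have h1 := pMap_pComap hT A.le_torsion
  rw [← h] at h1
  rw [← h1] at hx
  obtain ⟨y, hy, rfl⟩ := mem_pMap.1 hx
  exact hx0 hy

omit [Finite G] in
include hp hG hT in
theorem AtomSubgroup.pComap_lt_top (A : AtomSubgroup G p) : pComap p A.1 < ⊤ := by
  rw [lt_top_iff_ne_top]
  intro h
  have h1 := pMap_pComap hT A.le_torsion
  rw [h, ← hT] at h1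
  exact (A.lt_torsion hp hG hT).ne h1.symm

include hp hG hT in
-- The chain 0 < A < T < p⁻¹A < G, together with A < C < p⁻¹A for C of type `cyc A`, puts a subgroup
-- strictly between any two comparable subgroups of non-linked types; the other pairs of types
-- cannot be strictly comparable.
theorem link_of_covBy {H K : AddSubgroup G} (h : H ⋖ K) {s t : SpokeVertex (AtomSubgroup G p)}
    (hs : HasKind H s) (ht : HasKind K t) : Link s t := by
  obtain ⟨A₀⟩ : Nonempty (AtomSubgroup G p) := by
    have := natCard_atomSubgroup hp hG hT
    exact (Nat.card_pos_iff.1 (by omega)).1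
  have hlt := h.lt
  have hno := h.2
  have b1 := fun A : AtomSubgroup G p => A.bot_lt hp
  have b2 := fun A : AtomSubgroup G p => A.lt_torsion hp hG hT
  have b3 := fun A : AtomSubgroup G p => A.torsion_lt_pComap hp hT
  have b4 := fun A : AtomSubgroup G p => A.pComap_lt_top hp hG hT
  have cge : ∀ {H : AddSubgroup G} {A : AtomSubgroup G p}, HasKind H (cyc A) → A.1 < H := by
    rintro H A ⟨c1, c2, c3, c4⟩
    refine lt_of_le_of_ne (c3 ▸ inf_le_left) ?_
    rintro rfl
    exact c1 A.le_torsion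
  have cle : ∀ {H : AddSubgroup G} {A : AtomSubgroup G p}, HasKind H (cyc A) →
      H < pComap p A.1 := by
    rintro H A ⟨c1, c2, c3, c4⟩
    refine lt_of_le_of_ne (fun x hx => ?_) ?_
    · rw [mem_pComap, ← c4]
      exact ⟨x, hx, rfl⟩
    · rintro rfl
      exact c2 (b3 A).le
  cases s with
  | bot =>
    obtain rfl : H = ⊥ := hs
    cases t with
    | bot => exact absurd hlt (ht ▸ lt_irrefl _)
    | mid => exact absurd ((b2 A₀).trans_eq ht.symm) (hno (b1 A₀))
    | top => exact absurd (((b2 A₀).trans ((b3 A₀).trans (b4 A₀))).trans_eq ht.symm) (hno (b1 A₀))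
    | atom A => exact Link.bot_atom A
    | cyc A => exact absurd (cge ht) (hno (b1 A))
    | coatom A => exact absurd (((b2 A).trans (b3 A)).trans_eq ht.symm) (hno (b1 A))
  | mid =>
    obtain rfl : H = torsionSubgroup G p := hs
    cases t with
    | bot => exact absurd (hlt.trans_eq ht) not_lt_bot
    | mid => exact absurd hlt (ht ▸ lt_irrefl _)
    | top => exact absurd ((b4 A₀).trans_eq ht.symm) (hno (b3 A₀))
    | atom A => exact absurd (hlt.trans_eq ht) (b2 A).asymm
    | cyc A => exact absurd hlt.le ht.2.1
    | coatom A => exact Link.mid_coatom A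
  | top =>
    obtain rfl : H = ⊤ := hs
    exact absurd hlt not_top_lt
  | atom A =>
    obtain rfl : H = A.1 := hs
    cases t with
    | bot => exact absurd (hlt.trans_eq ht) not_lt_bot
    | mid => exact Link.atom_mid A
    | top => exact absurd (((b3 A).trans (b4 A)).trans_eq ht.symm) (hno (b2 A))
    | atom B =>
      obtain rfl : K = B.1 := ht
      exact absurd (congrArg Subtype.val (A.eq_of_le B hlt.le)) hlt.ne
    | cyc B =>
      obtain rfl : A = B := A.eq_of_le B (ht.2.2.1 ▸ le_inf hlt.le A.le_torsion)
      exact Link.atom_cyc A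
    | coatom B => exact absurd ((b3 B).trans_eq ht.symm) (hno (b2 A))
  | coatom A =>
    obtain rfl : H = pComap p A.1 := hs
    cases t with
    | bot => exact absurd (hlt.trans_eq ht) not_lt_bot
    | mid => exact absurd (hlt.trans_eq ht) (b3 A).asymm
    | top => exact Link.coatom_top A
    | atom B => exact absurd ((b3 A).trans (hlt.trans_eq ht)) (b2 B).asymm
    | cyc B => exact absurd ((b3 A).trans hlt).le ht.2.1
    | coatom B =>
      obtain rfl : K = pComap p B.1 := ht
      obtain rfl : A = B := by
        refine A.eq_of_le B ?_
        rw [← pMap_pComap hT A.le_torsion, ← pMap_pComap hT B.le_torsion]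
        exact AddSubgroup.map_mono hlt.le
      exact absurd hlt (lt_irrefl _)
  | cyc A =>
    have hmono : pMap p H ≤ pMap p K := AddSubgroup.map_mono hlt.le
    rw [hs.2.2.2] at hmono
    cases t with
    | bot => exact absurd (hlt.trans_eq ht) not_lt_bot
    | mid => exact absurd (hlt.trans_eq ht).le hs.1
    | top => exact absurd ((b4 A).trans_eq ht.symm) (hno (cle hs))
    | atom B => exact absurd ((hlt.trans_eq ht).trans (b2 B)).le hs.1
    | coatom B =>
      obtain rfl : K = pComap p B.1 := ht
      rw [pMap_pComap hT B.le_torsion] at hmono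
      obtain rfl : A = B := A.eq_of_le B hmono
      exact Link.cyc_coatom A
    | cyc B =>
      rw [ht.2.2.2] at hmono
      obtain rfl : A = B := A.eq_of_le B hmono
      -- Two subgroups H < K over the same A are impossible: for x in K some y in H has py = px, so
      -- x − y lies in K ∩ T = A ≤ H, and x is in H.
      refine absurd (fun x hx => ?_) hlt.not_ge
      have hpx : p • x ∈ pMap p K := ⟨x, hx, rfl⟩
      rw [ht.2.2.2, ← hs.2.2.2] at hpx
      obtain ⟨y, hy, hxy⟩ := mem_pMap.1 hpx
      have hd : x - y ∈ K ⊓ torsionSubgroup G p := by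
        refine ⟨AddSubgroup.sub_mem K hx (hlt.le hy), ?_⟩
        change p • (x - y) = 0
        rw [smul_sub, hxy, sub_self]
      rw [ht.2.2.1] at hd
      simpa using add_mem ((cge hs).le hd) hy

include hp hG hT in
-- Since T = pG, a generator w of A is p • u for some u, and the cyclic group generated by u has the
-- required type.
theorem exists_hasKind_cyc (A : AtomSubgroup G p) : ∃ C : AddSubgroup G, HasKind C (cyc A) := by
  obtain ⟨w, hw, hw0⟩ := A.exists_ne_zero hp
  have hwT := A.le_torsion hw
  have hAw := A.zmultiples_eq hp hw hw0
  have hord := natCard_zmultiples_of_mem_torsion hp hwT hw0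
  rw [Nat.card_zmultiples] at hord
  rw [hT] at hwT
  obtain ⟨u, -, hu⟩ := mem_pMap.1 hwT
  have hinf : AddSubgroup.zmultiples u ⊓ torsionSubgroup G p = A.1 := by
    refine le_antisymm ?_ (le_inf ?_ A.le_torsion)
    · rintro _ ⟨⟨z, rfl⟩, hz⟩
      have hz' : z • w = 0 := by
        rw [← hu, smul_comm]; exact hz
      obtain ⟨k, rfl⟩ := addOrderOf_dvd_iff_zsmul_eq_zero.2 hz'
      rw [hord, ← hAw, ← hu]
      exact ⟨k, by simp only [mul_comm (p : ℤ), mul_smul, natCast_zsmul]⟩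
    · rw [← hAw, AddSubgroup.zmultiples_le, ← hu]
      exact AddSubgroup.nsmul_mem _ (AddSubgroup.mem_zmultiples u) p
  refine ⟨AddSubgroup.zmultiples u, fun h => ?_, fun h => ?_, hinf, ?_⟩
  · exact hw0 (hu ▸ h (AddSubgroup.mem_zmultiples u))
  · rw [inf_eq_right.2 h] at hinf
    exact (A.lt_torsion hp hG hT).ne hinf.symm
  · rw [pMap, AddMonoidHom.map_zmultiples]
    exact (congrArg AddSubgroup.zmultiples hu).trans hAw

/-- The exponent of the order of a subgroup of the given kind. -/
def SpokeVertex.level {ι : Type*} : SpokeVertex ι → ℕ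
  | bot => 0
  | atom _ => 1
  | mid => 2
  | cyc _ => 2
  | coatom _ => 3
  | top => 4

omit [Finite G] in
include hG hT in
theorem natCard_of_hasKind {H : AddSubgroup G} {t : SpokeVertex (AtomSubgroup G p)}
    (h : HasKind H t) : Nat.card H = p ^ t.level := by
  cases t with
  | bot => obtain rfl : H = ⊥ := h; simp [level]
  | mid => obtain rfl : H = torsionSubgroup G p := h; exact natCard_torsionSubgroup hG hT
  | top => obtain rfl : H = ⊤ := h; rw [AddSubgroup.card_top, hG]; rfl
  | atom A => obtain rfl : H = A.1 := h; rw [A.2, level, pow_one]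
  | cyc A => rw [natCard_eq_mul (p := p), h.2.2.1, h.2.2.2, A.2, level, sq]
  | coatom A =>
    obtain rfl : H = pComap p A.1 := h
    rw [natCard_eq_mul (p := p), pMap_pComap hT A.le_torsion,
      inf_eq_right.2 (torsion_le_pComap _), A.2, natCard_torsionSubgroup hG hT, level]
    ring

omit [Finite G] in
include hp hG hT in
-- The order separates all types except T from the middle subgroups, which do not contain T. Within
-- a level, A is recovered from the subgroup itself, its intersection with T, or its image under p.
theorem eq_of_hasKind {H : AddSubgroup G} {s t : SpokeVertex (AtomSubgroup G p)}
    (hs : HasKind H s) (ht : HasKind H t) : s = t := by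
  have hl : s.level = t.level := Nat.pow_right_injective hp.two_le
    ((natCard_of_hasKind hG hT hs).symm.trans (natCard_of_hasKind hG hT ht))
  cases s <;> cases t <;> first | rfl | (simp [level] at hl; done) | skip
  · exact absurd (le_of_eq hs.symm) ht.2.1
  · exact congrArg atom (Subtype.ext (hs.symm.trans ht))
  · exact absurd (le_of_eq ht.symm) hs.2.1
  · exact congrArg cyc (Subtype.ext (hs.2.2.1.symm.trans ht.2.2.1))
  · rename_i A B
    have h := congrArg (pMap p) (hs.symm.trans ht)
    rw [pMap_pComap hT A.le_torsion, pMap_pComap hT B.le_torsion] at h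
    exact congrArg coatom (Subtype.ext h)

include hp hG hT in
theorem embedsInGenus_subgroupLatticeGraph_iff (g : ℕ) :
    (subgroupLatticeGraph G).EmbedsInGenus g ↔ p ≤ 4 * g + 1 := by
  have hI := natCard_atomSubgroup hp hG hT
  constructor
  · intro hg
    have : Fintype (AtomSubgroup G p) := Fintype.ofFinite _
    have hex : ∀ t : SpokeVertex (AtomSubgroup G p), ∃ H : AddSubgroup G, HasKind H t := by
      intro t
      cases t with
      | bot => exact ⟨_, rfl⟩
      | mid => exact ⟨_, rfl⟩
      | top => exact ⟨_, rfl⟩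
      | atom A => exact ⟨_, rfl⟩
      | coatom A => exact ⟨_, rfl⟩
      | cyc A => exact exists_hasKind_cyc hp hG hT A
    -- This selects one middle subgroup for each A. The edges from T to the coatoms are not needed
    -- for the lower bound.
    choose φ hφ using hex
    have hcov : ∀ s t, φ s ≤ φ t → t.level = s.level + 1 →
        (subgroupLatticeGraph G).Adj (φ s) (φ t) := by
      intro s t hle hl
      refine SimpleGraph.hasse_adj.2 (Or.inl (AddSubgroup.covBy_of_natCard_eq_mul hp hle ?_))
      rw [natCard_of_hasKind hG hT (hφ s), natCard_of_hasKind hG hT (hφ t), hl, pow_succ']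
    have h := hg.card_le_of_spokes φ
      (fun s t hst => eq_of_hasKind hp hG hT (hφ s) (hst ▸ hφ t)) ?_
    · rw [← Nat.card_eq_fintype_card, hI] at h
      omega
    · have e1 : φ bot = ⊥ := hφ bot
      have e2 : φ mid = torsionSubgroup G p := hφ mid
      have e3 : φ top = ⊤ := hφ top
      have e4 : ∀ A, φ (atom A) = A.1 := fun A => hφ (atom A)
      have e5 : ∀ A, φ (coatom A) = pComap p A.1 := fun A => hφ (coatom A)
      rintro ⟨j, A⟩
      fin_cases j
      · exact hcov bot (atom A) (by rw [e1]; exact bot_le) rfl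
      · exact (hcov (atom A) mid (by rw [e2, e4]; exact A.le_torsion) rfl).symm
      · refine (hcov (atom A) (cyc A) ?_ rfl).symm
        rw [e4, ← (hφ (cyc A)).2.2.1]
        exact inf_le_left
      · refine (hcov (cyc A) (coatom A) ?_ rfl).symm
        intro x hx
        rw [e5, mem_pComap, ← (hφ (cyc A)).2.2.2]
        exact ⟨x, hx, rfl⟩
      · exact (hcov (coatom A) top (by rw [e3]; exact le_top) rfl).symm
  · intro hg
    choose c hc using exists_hasKind hp hG hT
    have : Fintype (AtomSubgroup G p) := Fintype.ofFinite _
    have hcard : Fintype.card (AtomSubgroup G p) ≤ Fintype.card (ZMod (4 * g + 2)) := by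
      rw [← Nat.card_eq_fintype_card, hI, ZMod.card]; omega
    obtain ⟨e⟩ := Function.Embedding.nonempty_of_card_le hcard
    refine SimpleGraph.embedsInGenus_of_spokes _ c (fun H K h => ?_) (fun H K h => ?_) e e.injective
    · have hH := hc H
      have hK := hc K
      rw [← h] at hK
      generalize c H = t at hH hK
      cases t with
      | cyc A => exact Or.inr ⟨A, rfl⟩
      | _ => exact Or.inl (hH.trans hK.symm)
    · rcases SimpleGraph.hasse_adj.1 h with h | h
      · exact Or.inl (link_of_covBy hp hG hT h (hc H) (hc K))
      · exact Or.inr (link_of_covBy hp hG hT h (hc K) (hc H))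

end HomocyclicGroup

/-! ### The group ℤ/p² × ℤ/p² and the conclusion -/

theorem ZMod.nsmul_eq_zero_iff_exists_sq {p : ℕ} (hp : p.Prime) (x : ZMod (p ^ 2)) :
    p • x = 0 ↔ ∃ y : ZMod (p ^ 2), p • y = x := by
  have : NeZero (p ^ 2) := ⟨pow_ne_zero 2 hp.ne_zero⟩
  constructor
  · intro h
    rw [← ZMod.natCast_zmod_val x, nsmul_eq_mul, ← Nat.cast_mul, ZMod.natCast_eq_zero_iff] at h
    obtain ⟨k, hk⟩ : p ∣ x.val :=
      Nat.dvd_of_mul_dvd_mul_left hp.pos ((dvd_of_eq (sq p).symm).trans h)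
    refine ⟨k, ?_⟩
    rw [← ZMod.natCast_zmod_val x, hk, nsmul_eq_mul, Nat.cast_mul]
  · rintro ⟨y, rfl⟩
    rw [← mul_smul, ← sq, nsmul_eq_mul, ZMod.natCast_self, zero_mul]

theorem torsionSubgroup_zmod_sq_prod {p : ℕ} (hp : p.Prime) :
    torsionSubgroup (ZMod (p ^ 2) × ZMod (p ^ 2)) p = pMap p ⊤ := by
  ext ⟨x, y⟩
  rw [mem_torsionSubgroup, mem_pMap, Prod.smul_mk, Prod.mk_eq_zero,
    ZMod.nsmul_eq_zero_iff_exists_sq hp, ZMod.nsmul_eq_zero_iff_exists_sq hp]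
  constructor
  · rintro ⟨⟨a, rfl⟩, ⟨b, rfl⟩⟩
    exact ⟨(a, b), trivial, rfl⟩
  · rintro ⟨⟨a, b⟩, -, h⟩
    exact ⟨⟨a, congrArg Prod.fst h⟩, ⟨b, congrArg Prod.snd h⟩⟩

theorem proposition3p3 (p : ℕ) (hp : p.Prime) :
    (subgroupLatticeGraph (ZMod (p ^ 2) × ZMod (p ^ 2))).genus
      = ((⌈((p : ℝ) - 1) / 4⌉₊ : ℕ) : ℕ∞) := by
  have : NeZero (p ^ 2) := ⟨pow_ne_zero 2 hp.ne_zero⟩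
  have hG : Nat.card (ZMod (p ^ 2) × ZMod (p ^ 2)) = p ^ 4 := by
    rw [Nat.card_prod, Nat.card_zmod]; ring
  have hle : ∀ g : ℕ, p ≤ 4 * g + 1 ↔ ⌈((p : ℝ) - 1) / 4⌉₊ ≤ g := by
    intro g
    rw [Nat.ceil_le, div_le_iff₀ (by norm_num), sub_le_iff_le_add, mul_comm (g : ℝ)]
    exact_mod_cast Iff.rfl
  have hiff := fun g => (embedsInGenus_subgroupLatticeGraph_iff hp hG
    (torsionSubgroup_zmod_sq_prod hp) g).trans (hle g)
  -- The embeddable genera are exactly those from the ceiling upward, so the infimum is attained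
  -- there.
  refine le_antisymm (iInf₂_le _ ((hiff _).2 le_rfl)) (le_iInf₂ fun g hg => ?_)
  exact_mod_cast (hiff g).1 hg
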